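/- **Setting.** $K$ data sources generate data in discrete time $n=1,2,\dots$; $X^k_n$ is the observation of source $k\in[K]=\{1,\dots,K\}$ at time $n$. For $s\subseteq[K]$ let $\mathcal F^s_n=\sigma(X^k_m: k\in s,\ 1\le m\le n)$, $\mathcal F^s=\sigma(\mathcal F^s_n,n\ge1)$, and omit $s$ when $s=[K]$. Let $\mathcal P$ be a finite family of distributions of $X$, and $\mathsf P^s$ the restriction of $\mathsf P$ to $\mathcal F^s$. Let $\mathcal K$ be a family of subsets of $[K]$ (units); for each $e\in\mathcal K$ let $\mathcal H^e,\mathcal G^e$ be non-empty disjoint subfamilies of $\{\mathsf P^e:\mathsf P\in\mathcal P\}$. Put $\mathcal A(\mathsf P)=\{e\in\mathcal K:\mathsf P^e\in\mathcal G^e\}$. Let $\Psi$ be a family of subsets of $\mathcal K$, $\mathcal P_\Psi=\{\mathsf P\in\mathcal P:\mathsf P^e\in\mathcal H^e\cup\mathcal G^e\ \forall e\in\mathcal K,\ \mathcal A(\mathsf P)\in\Psi\}$, $\mathcal H_0=\mathcal P_{\{\emptyset\}}$ (assumed non-empty), $\mathcal H_{\Psi,e}=\{\mathsf P\in\mathcal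 P_\Psi\setminus\mathcal H_0: e\notin\mathcal A(\mathsf P)\}$ and $\mathcal G_{\Psi,e}=\{\mathsf P\in\mathcal P_\Psi: e\in\mathcal A(\mathsf P)\}$. **Assumptions.** (a) For all $e\in\mathcal K$, $\mathsf P\in\mathcal G_{\Psi,e}\cup\mathcal H_0$, $\mathsf Q\in\mathcal H_{\Psi,e}\cup\mathcal H_0$, $e\subseteq s\subseteq[K]$ and $n\ge1$, $\mathsf P$ and $\mathsf Q$ are mutually absolutely continuous on $\mathcal F^s_n$; $\Lambda_n(\mathsf P^s,\mathsf Q^s)$ is the likelihood ratio on $\mathcal F_n^s$ and $Z_n=\log\Lambda_n$. (b) For all $e\in\mathcal K$, $\mathsf P\in\mathcal G_{\Psi,e}$, $\mathsf Q\in\mathcal H_{\Psi,e}\cup\mathcal H_0$, $e\subseteq s\subseteq[K]$ there is a (necessarily unique) number $\mathcal I(\mathsf P,\mathsf Q;s)>0$ with $\mathsf P(\max_{1\le m\le n}Z_m(\mathsf P^s,\mathsf Q^s)\ge n\rho)\to0$ for every $\rho>\mathcal I(\mathsf P,\mathsf Q;s)$ and $\sum_{n\ge1}\mathsf P(Z_n(\mathsf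 P^s,\mathsf Q^s)<n\rho)<\infty$ for every $\rho<\mathcal I(\mathsf P,\mathsf Q;s)$, and the same holds with $\mathsf P$ and $\mathsf Q$ interchanged. Put $\mathcal I(\mathsf P,\mathcal Q;s)=\min_{\mathsf Q\in\mathcal Q}\mathcal I(\mathsf P,\mathsf Q;s)$ ($=\infty$ if $\mathcal Q=\emptyset$), and $\mathcal I(\mathsf P,\mathcal Q)=\mathcal I(\mathsf P,\mathcal Q;[K])$. **Classes of tests.** A test is a pair $(T,D)$, where $T$ is an $(\mathcal F_n)$-stopping time with values in $\{1,2,\dots\}\cup\{\infty\}$ and $D$ is $\Psi$-valued with $\{T=n,D=A\}\in\mathcal F_n$ for all $n\ge 1$, $A\in\Psi$. Error events are understood on $\{T<\infty\}$. $\mathcal D_\Psi(\alpha,\beta)$ is the class of tests with $\mathsf P(D\ne\emptyset)\le\alpha$ for $\mathsf P\in\mathcal H_0$ and $\mathsf P(D=\emptyset)\le\beta$ for $\mathsf P\in\mathcal P_\Psi\setminus\mathcal H_0$; $\mathcal C_\Psi(\alpha,\beta,\gamma,\delta)$ is the class of tests in $\mathcal D_\Psi(\alpha,\beta)$ with $\mathsf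 P(D\setminus\mathcal A(\mathsf P)\ne\emptyset)\le\gamma$ and $\mathsf P(\mathcal A(\mathsf P)\setminus D\ne\emptyset,D\ne\emptyset)\le\delta$ for $\mathsf P\in\mathcal P_\Psi\setminus\mathcal H_0$; $\mathcal E_\Psi(\gamma,\delta)$ is the class of tests with $\mathsf P(D\setminus\mathcal A(\mathsf P)\ne\emptyset)\le\gamma$ and $\mathsf P(\mathcal A(\mathsf P)\setminus D\ne\emptyset)\le\delta$ for $\mathsf P\in\mathcal P_\Psi$. **Proposed tests.** For each $e\in\mathcal K$ choose subsystems $s_e,s'_e$ with $e\subseteq s_e\cap s'_e\subseteq[K]$ and reference distributions $\mathsf P_0,\mathsf P_0'\in\mathcal H_0$ (which may depend on $e$), and let $$\Lambda_{e,\rm det}(n)=\frac{\max_{\mathsf P\in\mathcal G_{\Psi,e}}\Lambda_n(\mathsf P^{s_e},\mathsf P_0^{s_e})}{\max_{\mathsf P\in\mathcal H_0}\Lambda_n(\mathsf P^{s_e},\mathsf P_0^{s_e})},\qquad \Lambda_{e,\rm iso}(n)=\frac{\max_{\mathsf P\in\mathcal G_{\Psi,e}}\Lambda_n(\mathsf P^{s'_e},\mathsf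 P_0'^{\,s'_e})}{\max_{\mathsf P\in\mathcal H_{\Psi,e}}\Lambda_n(\mathsf P^{s'_e},\mathsf P_0'^{\,s'_e})}$$ ($\max\emptyset=0$, $x/0=\infty$ for $x>0$), $D_{\rm iso}(n)=\{e\in\mathcal K:\Lambda_{e,\rm iso}(n)>1\}$. For positive thresholds $A_e,B_e,C_e,D_e$ let (infima over $n\ge1$) $T_0=\inf\{n:\Lambda_{e,\rm det}(n)\le1/C_e\ \forall e\in\mathcal K\}$, $T_{det}=\inf\{n:\Lambda_{e,\rm det}(n)\ge D_e\text{ for some }e\in\mathcal K\}$ and $$T_{joint}=\inf\{n:\Lambda_{e,\rm det}(n)\ge D_e\text{ for some }e\in\mathcal K,\ \Lambda_{e,\rm iso}(n)\notin(1/A_e,B_e)\ \forall e\in\mathcal K,\ D_{\rm iso}(n)\in\Psi\setminus\{\emptyset\}\}.$$ Then $\chi^*_{det}=(T^*_{det},D^*_{det})$ has $T^*_{det}=\min\{T_0,T_{det}\}$ and any decision $D^*_{det}$ such that, when $T^*_{det}<\infty$, $D^*_{det}=\emptyset\Leftrightarrow T_0<T_{det}$; $\chi^*=(T^*,D^*)$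 has $T^*=\min\{T_0,T_{joint}\}$, $D^*=\emptyset$ if $T_0<T_{joint}$, and $D^*=D_{\rm iso}(T^*)$ if $T_{joint}\le T_0$, $T_{joint}<\infty$; $\chi^*_{fwer}=(T^*_{fwer},D^*_{fwer})$ is $\chi^*$ with $C_e=A_e$, $D_e=B_e$ for all $e$. The thresholds vary with the tolerance levels so that $\chi^*_{det}\in\mathcal D_\Psi(\alpha,\beta)$, $\chi^*\in\mathcal C_\Psi(\alpha,\beta,\gamma,\delta)$, $\chi^*_{fwer}\in\mathcal E_\Psi(\gamma,\delta)$, respectively, and, as the levels go to $0$, $\log A_e\sim|\log\delta|$, $\log B_e\sim|\log\gamma|$ and, for $\chi^*_{det}$ and $\chi^*$, $\log C_e\sim|\log\beta|$, $\log D_e\sim|\log\alpha|$, for every $e\in\mathcal K$. All limits are along arbitrary sequences of levels in $(0,1)$; $x\sim y$ means $x/y\to1$ and $x\gg y$ means $y/x\to0$. **Theorem.** Suppose $\emptyset\in\Psi$, $\mathsf P\in\mathcal P_\Psi\setminus\mathcal H_0$, and $$\max_{e\in\mathcal A(\mathsf P)}\mathcal I(\mathsf P,\mathcal H_0;s_e)=\mathcal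 I(\mathsf P,\mathcal H_0),\tag{1}$$ which is the case when $s_e=[K]$ for some $e\in\mathcal A(\mathsf P)$. Then, as $\alpha,\beta\to0$, $$\mathsf E_{\mathsf P}[T^*_{det}]\sim\frac{|\log\alpha|}{\mathcal I(\mathsf P,\mathcal H_0)}\sim\inf\{\mathsf E_{\mathsf P}[T]:(T,D)\in\mathcal D_\Psi(\alpha,\beta)\},$$ and, as $\alpha,\beta,\gamma,\delta\to0$ such that $|\log\alpha|\gg|\log\gamma|\vee|\log\delta|$, $$\mathsf E_{\mathsf P}[T^*]\sim\frac{|\log\alpha|}{\mathcal I(\mathsf P,\mathcal H_0)}\sim\inf\{\mathsf E_{\mathsf P}[T]:(T,D)\in\mathcal C_\Psi(\alpha,\beta,\gamma,\delta)\}.$$ If also $$\min_{e\in\mathcal A(\mathsf P)}\mathcal I(\mathsf P,\mathcal H_{\Psi,e};s'_e)=\min_{e\in\mathcal A(\mathsf P)}\mathcal I(\mathsf P,\mathcal H_{\Psi,e}),$$ then, as $\gamma,\delta\to0$ such that $|\log\gamma|\gg|\log\delta|$, $$\mathsf E_{\mathsf P}[T^*_{fwer}]\sim\max_{e\in\mathcal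 A(\mathsf P)}\frac{|\log\gamma|}{\mathcal I(\mathsf P,\mathcal H_0)\wedge\mathcal I(\mathsf P,\mathcal H_{\Psi,e})}\sim\inf\{\mathsf E_{\mathsf P}[T]:(T,D)\in\mathcal E_\Psi(\gamma,\delta)\}.$$ -/

import Mathlib

open MeasureTheory Filter Topology
open scoped ENNReal Asymptotics

namespace SeqDetIso

universe u

noncomputable section

/-! ## Data and filtrations -/

/-- The space of all observations of `K` data sources, where source `k` takes values in `E k`.
For `ω : Obs E`, `ω m k` is the value generated by source `k` at time `m + 1`
(times are `1, 2, …`). -/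
abbrev Obs {K : ℕ} (E : Fin K → Type u) : Type u := ℕ → (k : Fin K) → E k

section Data

variable {K : ℕ} {E : Fin K → Type u} [∀ k, MeasurableSpace (E k)]

/-- `𝓕ₙˢ`: the σ-field generated by the observations of the sources in `s` up to time `n`. -/
@[reducible]
def sigmaUpTo (E : Fin K → Type u) [∀ k, MeasurableSpace (E k)] (s : Finset (Fin K)) (n : ℕ) :
    MeasurableSpace (Obs E) :=
  ⨆ m ∈ {m : ℕ | m < n}, ⨆ k ∈ s,
    MeasurableSpace.comap (fun ω : Obs E => ω m k) inferInstance

/-- `𝓕ˢ`: the σ-field generated by all the observations of the sources in `s`. -/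
@[reducible]
def sigmaAll (E : Fin K → Type u) [∀ k, MeasurableSpace (E k)] (s : Finset (Fin K)) :
    MeasurableSpace (Obs E) :=
  ⨆ n, sigmaUpTo E s n

lemma sigmaUpTo_le (s : Finset (Fin K)) (n : ℕ) :
    sigmaUpTo E s n ≤ (inferInstance : MeasurableSpace (Obs E)) := by
  refine iSup₂_le fun m _ => iSup₂_le fun k _ => ?_
  exact Measurable.comap_le ((measurable_pi_apply k).comp (measurable_pi_apply m))

lemma sigmaAll_le (s : Finset (Fin K)) :
    sigmaAll E s ≤ (inferInstance : MeasurableSpace (Obs E)) :=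
  iSup_le fun n => sigmaUpTo_le s n

lemma sigmaUpTo_mono (s : Finset (Fin K)) : Monotone (sigmaUpTo E s) := by
  intro n n' h
  refine iSup₂_le fun m hm => ?_
  exact le_iSup₂_of_le (f := fun (m : ℕ) (_ : m ∈ {m : ℕ | m < n'}) => ⨆ k ∈ s,
    MeasurableSpace.comap (fun ω : Obs E => ω m k) inferInstance) m
      (lt_of_lt_of_le hm h) le_rfl

/-- The filtration `(𝓕ₙ)` generated by the observations of all the sources. -/
def obsFiltration (E : Fin K → Type u) [∀ k, MeasurableSpace (E k)] :
    Filtration ℕ (inferInstance : MeasurableSpace (Obs E)) where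
  seq := sigmaUpTo E Finset.univ
  mono' := sigmaUpTo_mono Finset.univ
  le' := sigmaUpTo_le Finset.univ

/-- `Pˢ`: the restriction of `P` to `𝓕ˢ`, that is, the marginal distribution of the
observations of the sources in `s`. -/
def marginal (P : Measure (Obs E)) (s : Finset (Fin K)) : @Measure (Obs E) (sigmaAll E s) :=
  P.trim (sigmaAll_le s)

/-- The restriction of `P` to `𝓕ₙˢ`. -/
def marginalUpTo (P : Measure (Obs E)) (s : Finset (Fin K)) (n : ℕ) :
    @Measure (Obs E) (sigmaUpTo E s n) :=
  P.trim (sigmaUpTo_le s n)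

/-- The likelihood ratio `Λₙ(Pˢ, Qˢ)`: the Radon-Nikodym derivative of `Pˢ` with respect to `Qˢ`
on `𝓕ₙˢ`. -/
def lik (P Q : Measure (Obs E)) (s : Finset (Fin K)) (n : ℕ) : Obs E → ℝ≥0∞ :=
  (marginalUpTo P s n).rnDeriv (marginalUpTo Q s n)

/-- The log-likelihood ratio `Zₙ(Pˢ, Qˢ) = log Λₙ(Pˢ, Qˢ)`. -/
def logLik (P Q : Measure (Obs E)) (s : Finset (Fin K)) (n : ℕ) : Obs E → ℝ :=
  llr (marginalUpTo P s n) (marginalUpTo Q s n)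

/-! ## Information numbers -/

/-- `c` is a positive number that governs the growth of `Zₙ(Pˢ, Qˢ)` under `P`:
`P(max_{1 ≤ m ≤ n} Z_m ≥ n ρ) → 0` for every `ρ > c`, and `∑_{n ≥ 1} P(Zₙ < n ρ) < ∞` for
every `ρ < c`. -/
structure IsInfoNumber (P Q : Measure (Obs E)) (s : Finset (Fin K)) (c : ℝ) : Prop where
  pos : 0 < c
  max_series : ∀ ρ : ℝ, c < ρ →
    Tendsto (fun n : ℕ => P {ω | ∃ m : ℕ, 1 ≤ m ∧ m ≤ n ∧ (n : ℝ) * ρ ≤ logLik P Q s m ω})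
      atTop (𝓝 0)
  one_sided : ∀ ρ : ℝ, ρ < c →
    ∑' n : ℕ, P {ω | logLik P Q s (n + 1) ω < ((n + 1 : ℕ) : ℝ) * ρ} < ∞

/-- There is at most one such number. -/
lemma IsInfoNumber.unique {P Q : Measure (Obs E)} [IsProbabilityMeasure P]
    {s : Finset (Fin K)} {c d : ℝ} (hc : IsInfoNumber P Q s c) (hd : IsInfoNumber P Q s d) :
    c = d := by
  have key : ∀ {c d : ℝ}, IsInfoNumber P Q s c → IsInfoNumber P Q s d → ¬ c < d := by
    intro c d hc hd hlt
    obtain ⟨ρ, h1, h2⟩ := exists_between hlt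
    have ha := (hc.max_series ρ h1).comp (tendsto_add_atTop_nat 1)
    have hb := ENNReal.tendsto_atTop_zero_of_tsum_ne_top (hd.one_sided ρ h2).ne
    have hab := ha.add hb
    rw [add_zero] at hab
    have hge : ∀ n : ℕ, (1 : ℝ≥0∞) ≤
        P {ω | ∃ m : ℕ, 1 ≤ m ∧ m ≤ n + 1 ∧ ((n + 1 : ℕ) : ℝ) * ρ ≤ logLik P Q s m ω}
        + P {ω | logLik P Q s (n + 1) ω < ((n + 1 : ℕ) : ℝ) * ρ} := by
      intro n
      rw [← measure_univ (μ := P)]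
      refine le_trans (measure_mono fun ω _ => ?_) (measure_union_le _ _)
      rcases lt_or_ge (logLik P Q s (n + 1) ω) (((n + 1 : ℕ) : ℝ) * ρ) with h | h
      · exact Or.inr h
      · exact Or.inl ⟨n + 1, by omega, le_rfl, h⟩
    exact absurd (ge_of_tendsto' hab hge) (by simp)
  exact le_antisymm (not_lt.1 (key hd hc)) (not_lt.1 (key hc hd))

open Classical in
/-- The information number `𝓘(P, Q; s) = 𝓘(Pˢ, Qˢ)` (the value is only meaningful when an
information number exists, in which case it is unique). -/
def info (P Q : Measure (Obs E)) (s : Finset (Fin K)) : ℝ :=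
  if h : ∃ c, IsInfoNumber P Q s c then h.choose else 0

/-- `𝓘(P, 𝒬; s)`: the minimum of `𝓘(P, Q; s)` over the family `𝒬` (`∞` if `𝒬` is empty). -/
def infoFam (P : Measure (Obs E)) (𝒬 : Set (Measure (Obs E))) (s : Finset (Fin K)) : ℝ≥0∞ :=
  ⨅ Q ∈ 𝒬, ENNReal.ofReal (info P Q s)

end Data

/-! ## The testing problem -/

/-- The testing problem: a finite family of global distributions, a finite family of units
(subsets of sources) with a null and an alternative hypothesis for the marginal distribution of
each, and a family `Ψ` of sets of units to which the set of signals is known to belong. -/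
structure Problem (K : ℕ) (E : Fin K → Type u) [∀ k, MeasurableSpace (E k)] where
  /-- the family `𝒫` of plausible global distributions -/
  dists : Set (Measure (Obs E))
  dists_finite : dists.Finite
  dists_prob : ∀ P ∈ dists, IsProbabilityMeasure P
  /-- the family `𝒦` of units -/
  units : Finset (Finset (Fin K))
  /-- the null hypothesis `𝓗ᵉ` for the marginal distribution of `Xᵉ` -/
  null : ∀ e : Finset (Fin K), Set (@Measure (Obs E) (sigmaAll E e))
  /-- the alternative hypothesis `𝓖ᵉ` for the marginal distribution of `Xᵉ` -/
  alt : ∀ e : Finset (Fin K), Set (@Measure (Obs E) (sigmaAll E e))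
  null_nonempty : ∀ e ∈ units, (null e).Nonempty
  alt_nonempty : ∀ e ∈ units, (alt e).Nonempty
  null_subset : ∀ e ∈ units, null e ⊆ (fun P => marginal P e) '' dists
  alt_subset : ∀ e ∈ units, alt e ⊆ (fun P => marginal P e) '' dists
  null_disjoint_alt : ∀ e ∈ units, Disjoint (null e) (alt e)
  /-- the family `Ψ` of possible sets of signals -/
  Psi : Set (Finset (Finset (Fin K)))
  Psi_subset : ∀ A ∈ Psi, A ⊆ units

namespace Problem

variable {K : ℕ} {E : Fin K → Type u} [∀ k, MeasurableSpace (E k)] (S : Problem K E)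

open Classical in
/-- `𝓐(P)`: the set of signals under `P`. -/
def signals (P : Measure (Obs E)) : Finset (Finset (Fin K)) :=
  S.units.filter fun e => marginal P e ∈ S.alt e

/-- The global distributions compatible with a family `Φ` of sets of units. -/
def compatible (Φ : Set (Finset (Finset (Fin K)))) : Set (Measure (Obs E)) :=
  {P | P ∈ S.dists ∧ (∀ e ∈ S.units, marginal P e ∈ S.null e ∪ S.alt e) ∧ S.signals P ∈ Φ}

/-- `𝒫_Ψ`. -/
def distsPsi : Set (Measure (Obs E)) := S.compatible S.Psi

/-- `𝓗₀ = 𝒫_{∅}`: the global null distributions. -/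
def globalNull : Set (Measure (Obs E)) := S.compatible {∅}

/-- `𝓗_{Ψ,e}`: the non-null distributions in `𝒫_Ψ` under which `e` is not a signal. -/
def nullAt (e : Finset (Fin K)) : Set (Measure (Obs E)) :=
  {P | P ∈ S.distsPsi \ S.globalNull ∧ e ∉ S.signals P}

/-- `𝓖_{Ψ,e}`: the distributions in `𝒫_Ψ` under which `e` is a signal. -/
def altAt (e : Finset (Fin K)) : Set (Measure (Obs E)) :=
  {P | P ∈ S.distsPsi ∧ e ∈ S.signals P}

/-- Mutual absolute continuity, over finite horizons, of the marginal distributions. -/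
def MutuallyAC : Prop :=
  ∀ e ∈ S.units, ∀ P ∈ S.altAt e ∪ S.globalNull, ∀ Q ∈ S.nullAt e ∪ S.globalNull,
    ∀ s : Finset (Fin K), e ⊆ s → ∀ n : ℕ, 1 ≤ n →
      (marginalUpTo P s n) ≪ (marginalUpTo Q s n) ∧ (marginalUpTo Q s n) ≪ (marginalUpTo P s n)

/-- Existence of the positive information numbers `𝓘(Pˢ, Qˢ)` and `𝓘(Qˢ, Pˢ)`. -/
def HasInfoNumbers : Prop :=
  ∀ e ∈ S.units, ∀ P ∈ S.altAt e, ∀ Q ∈ S.nullAt e ∪ S.globalNull,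
    ∀ s : Finset (Fin K), e ⊆ s →
      (∃ c, IsInfoNumber P Q s c) ∧ (∃ c, IsInfoNumber Q P s c)

/-! ## Tests and their errors -/

/-- `(T, D)` is a test: `T` is an `(𝓕ₙ)`-stopping time with values in `{1, 2, …} ∪ {∞}`, and `D` is
`Ψ`-valued and `𝓕_T`-measurable. -/
structure IsTest (T : Obs E → ℕ∞) (D : Obs E → Finset (Finset (Fin K))) : Prop where
  one_le : ∀ ω, 1 ≤ T ω
  stopping : IsStoppingTime (obsFiltration E) T
  mem_Psi : ∀ ω, D ω ∈ S.Psi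
  measurable : ∀ n : ℕ, 1 ≤ n → ∀ A ∈ S.Psi,
    MeasurableSet[sigmaUpTo E Finset.univ n] {ω | T ω = n ∧ D ω = A}

/-- A pair (stopping time, decision). -/
abbrev Pair (E : Fin K → Type u) : Type u := (Obs E → ℕ∞) × (Obs E → Finset (Finset (Fin K)))

/-- `𝓓_Ψ(α, β)`: tests with false alarm probability at most `α` and missed detection probability
at most `β`. As a decision is only made when sampling terminates, here and below the error events
are events on `{T < ∞}`. -/
def detClass (α β : ℝ) : Set (Pair E) :=
  {χ | S.IsTest χ.1 χ.2 ∧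
    (∀ P ∈ S.globalNull, P {ω | χ.1 ω < ⊤ ∧ χ.2 ω ≠ ∅} ≤ ENNReal.ofReal α) ∧
    (∀ P ∈ S.distsPsi \ S.globalNull, P {ω | χ.1 ω < ⊤ ∧ χ.2 ω = ∅} ≤ ENNReal.ofReal β)}

/-- `𝓒_Ψ(α, β, γ, δ)`: tests in `𝓓_Ψ(α, β)` that, under each non-null distribution, have false
positive probability at most `γ` and false negative probability at most `δ`. -/
def jointClass (α β γ δ : ℝ) : Set (Pair E) :=
  {χ | χ ∈ S.detClass α β ∧
    ∀ P ∈ S.distsPsi \ S.globalNull,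
      P {ω | χ.1 ω < ⊤ ∧ χ.2 ω \ S.signals P ≠ ∅} ≤ ENNReal.ofReal γ ∧
      P {ω | χ.1 ω < ⊤ ∧ S.signals P \ χ.2 ω ≠ ∅ ∧ χ.2 ω ≠ ∅} ≤ ENNReal.ofReal δ}

/-- `𝓔_Ψ(γ, δ)`: tests with familywise error control. -/
def fwerClass (γ δ : ℝ) : Set (Pair E) :=
  {χ | S.IsTest χ.1 χ.2 ∧
    ∀ P ∈ S.distsPsi,
      P {ω | χ.1 ω < ⊤ ∧ χ.2 ω \ S.signals P ≠ ∅} ≤ ENNReal.ofReal γ ∧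
      P {ω | χ.1 ω < ⊤ ∧ S.signals P \ χ.2 ω ≠ ∅} ≤ ENNReal.ofReal δ}

/-! ## Statistics and the proposed tests -/

/-- The detection statistic `Λ_{e,det}(n)` for the detection subsystem `s` and the reference
distribution `P₀`. Maxima over empty families are `0`, and `x / 0 = ∞` for `x > 0`. -/
def detStat (s : Finset (Fin K)) (P₀ : Measure (Obs E)) (e : Finset (Fin K)) (n : ℕ)
    (ω : Obs E) : ℝ≥0∞ :=
  (⨆ P ∈ S.altAt e, lik P P₀ s n ω) / (⨆ P ∈ S.globalNull, lik P P₀ s n ω)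

/-- The isolation statistic `Λ_{e,iso}(n)` for the isolation subsystem `s` and the reference
distribution `P₀`, with the same conventions. -/
def isoStat (s : Finset (Fin K)) (P₀ : Measure (Obs E)) (e : Finset (Fin K)) (n : ℕ)
    (ω : Obs E) : ℝ≥0∞ :=
  (⨆ P ∈ S.altAt e, lik P P₀ s n ω) / (⨆ P ∈ S.nullAt e, lik P P₀ s n ω)

end Problem

/-- The first time `n ∈ {1, 2, …}` at which `p n` holds, `∞` if there is none. -/
def firstTime (p : ℕ → Prop) : ℕ∞ := ⨅ n ∈ {n : ℕ | 1 ≤ n ∧ p n}, (n : ℕ∞)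

/-- A choice of the detection and isolation subsystems `s_e`, `s'_e` of every unit, and of the
reference distributions in the corresponding statistics. -/
structure Subsystems {K : ℕ} {E : Fin K → Type u} [∀ k, MeasurableSpace (E k)]
    (S : Problem K E) where
  /-- the detection subsystem `s_e` -/
  det : Finset (Fin K) → Finset (Fin K)
  /-- the isolation subsystem `s'_e` -/
  iso : Finset (Fin K) → Finset (Fin K)
  /-- the reference distribution in the detection statistic of `e` -/
  refDet : Finset (Fin K) → Measure (Obs E)
  /-- the reference distribution in the isolation statistic of `e` -/
  refIso : Finset (Fin K) → Measure (Obs E)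
  subset_det : ∀ e ∈ S.units, e ⊆ det e
  subset_iso : ∀ e ∈ S.units, e ⊆ iso e
  refDet_mem : ∀ e ∈ S.units, refDet e ∈ S.globalNull
  refIso_mem : ∀ e ∈ S.units, refIso e ∈ S.globalNull

namespace Subsystems

variable {K : ℕ} {E : Fin K → Type u} [∀ k, MeasurableSpace (E k)] {S : Problem K E}
  (σ : Subsystems S)

/-- `Λ_{e,det}(n)`. -/
def LamDet (e : Finset (Fin K)) (n : ℕ) (ω : Obs E) : ℝ≥0∞ :=
  S.detStat (σ.det e) (σ.refDet e) e n ω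

/-- `Λ_{e,iso}(n)`. -/
def LamIso (e : Finset (Fin K)) (n : ℕ) (ω : Obs E) : ℝ≥0∞ :=
  S.isoStat (σ.iso e) (σ.refIso e) e n ω

open Classical in
/-- `D_iso(n)`: the units whose isolation statistic at time `n` exceeds `1`. -/
def Diso (n : ℕ) (ω : Obs E) : Finset (Finset (Fin K)) :=
  S.units.filter fun e => 1 < σ.LamIso e n ω

/-- `T₀`. -/
def T0 (C : Finset (Fin K) → ℝ) (ω : Obs E) : ℕ∞ :=
  firstTime fun n => ∀ e ∈ S.units, σ.LamDet e n ω ≤ ENNReal.ofReal (1 / C e)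

/-- `T_det`. -/
def Tdet (D : Finset (Fin K) → ℝ) (ω : Obs E) : ℕ∞ :=
  firstTime fun n => ∃ e ∈ S.units, ENNReal.ofReal (D e) ≤ σ.LamDet e n ω

/-- `T_joint`. -/
def Tjoint (A B D : Finset (Fin K) → ℝ) (ω : Obs E) : ℕ∞ :=
  firstTime fun n =>
    (∃ e ∈ S.units, ENNReal.ofReal (D e) ≤ σ.LamDet e n ω) ∧
    (∀ e ∈ S.units,
      σ.LamIso e n ω ∉ Set.Ioo (ENNReal.ofReal (1 / A e)) (ENNReal.ofReal (B e))) ∧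
    σ.Diso n ω ∈ S.Psi \ {∅}

/-- `T*_det`, the stopping time of the test for pure detection. -/
def TstarDet (C D : Finset (Fin K) → ℝ) (ω : Obs E) : ℕ∞ := min (σ.T0 C ω) (σ.Tdet D ω)

/-- `D` is a version of `D*_det`: upon stopping, no unit is selected if and only if
`T₀ < T_det`. -/
def IsDstarDet (C D : Finset (Fin K) → ℝ) (d : Obs E → Finset (Finset (Fin K))) : Prop :=
  ∀ ω, σ.TstarDet C D ω < ⊤ → (d ω = ∅ ↔ σ.T0 C ω < σ.Tdet D ω)

/-- `T*`, the stopping time of the test for joint detection and isolation. -/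
def Tstar (A B C D : Finset (Fin K) → ℝ) (ω : Obs E) : ℕ∞ :=
  min (σ.T0 C ω) (σ.Tjoint A B D ω)

open Classical in
/-- `D*`, the decision of the test for joint detection and isolation (with value `∅` when sampling
never terminates). -/
def Dstar (A B C D : Finset (Fin K) → ℝ) (ω : Obs E) : Finset (Finset (Fin K)) :=
  if σ.T0 C ω < σ.Tjoint A B D ω ∨ σ.Tstar A B C D ω = ⊤ then ∅
  else σ.Diso (σ.Tstar A B C D ω).toNat ω

/-- `χ* = (T*, D*)`. -/
def chiStar (A B C D : Finset (Fin K) → ℝ) : Problem.Pair E :=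
  (σ.Tstar A B C D, σ.Dstar A B C D)

/-- `χ*_fwer`: the test `χ*` with `C_e = A_e` and `D_e = B_e` for every unit `e`. -/
def chiFwer (A B : Finset (Fin K) → ℝ) : Problem.Pair E := σ.chiStar A B A B

end Subsystems

/-! ## Asymptotics -/

section Asymptotics

variable {K : ℕ} {E : Fin K → Type u} [∀ k, MeasurableSpace (E k)]

/-- `E_P[T]`, with values in `[0, ∞]`. -/
def expTime (P : Measure (Obs E)) (T : Obs E → ℕ∞) : ℝ≥0∞ := ∫⁻ ω, (T ω : ℝ≥0∞) ∂P

/-- The optimal expected sample size under `P` in a class of tests. -/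
def optTime (P : Measure (Obs E)) (𝒞 : Set (Problem.Pair E)) : ℝ≥0∞ :=
  ⨅ χ ∈ 𝒞, expTime P χ.1

/-- `x_i ∼ y_i`: the ratio tends to `1`. -/
def AsympEq (x y : ℕ → ℝ≥0∞) : Prop := Tendsto (fun i => x i / y i) atTop (𝓝 1)

/-- A sequence of tolerance levels in `(0, 1)` that goes to `0`. -/
def IsLevelSeq (a : ℕ → ℝ) : Prop := (∀ i, a i ∈ Set.Ioo (0 : ℝ) 1) ∧ Tendsto a atTop (𝓝 0)

/-- `th`, a sequence of families of positive thresholds indexed by the units, satisfies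
`log th_e ∼ |log a|` for every unit `e`. -/
def IsThresholdSeq (S : Problem K E) (a : ℕ → ℝ) (th : ℕ → Finset (Fin K) → ℝ) : Prop :=
  ∀ e ∈ S.units, (∀ i, 0 < th i e) ∧
    Tendsto (fun i => Real.log (th i e) / |Real.log (a i)|) atTop (𝓝 1)

end Asymptotics

end

end SeqDetIso

open SeqDetIso

/-! Membership of the proposed tests in their classes is a hypothesis, so only expected sample sizes
have to be estimated: a lower bound for every test in a class and a matching upper bound for the
proposed one.

Lower bound. Let a test make some decision with `Q`-probability at most `a` and fail to make it with
`P`-probability at most `b` (on termination). Splitting according to the stopping time and changing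
measure, `P(T ≤ n)` is at most `b + exp(nρ) a` plus the probability that `Z_m(P, Q) ≥ nρ` for some
`m ≤ n`. With `ρ` slightly above the information number and `n` slightly below `|log a| / ρ` all
three terms vanish, so `E[T]` is asymptotically at least `|log a|` over that number
(`eventually_le_optTime`). This is applied to "something is selected" against the least favourable
global null and, for familywise control, to "`e` is selected" against distributions under which `e`
is not a signal.

Upper bound. By the chain rule for densities, if `P` contributes to the numerator of a mixed
statistic, the statistic is `P`-a.s. at least the smallest likelihood ratio of `P` against the
denominator family (`ae_le_ratio`); `ae_ratio_le` is the mirror image. Hence, once `n` times the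
growth rates exceeds the log-thresholds, the test has stopped by time `n` unless some log-likelihood
ratio lies below its linear growth. Those exceptional probabilities are summable with a sum
independent of the thresholds, so `E[T]` exceeds the deterministic crossing time by a bounded amount
(`expTime_le`).

Only one unit has to cross its detection threshold, and (1) supplies a signal whose subsystem has
the full information. Isolation thresholds of smaller logarithmic order are crossed sooner at any
positive rate. In the familywise case `|log γ|` governs both detection and the isolation of true
signals, and the relevant rate is the information against the union of all the competing families.
-/

namespace SeqDetIso

/-! ### Change of measure for two measures on one σ-field. -/

section ChangeOfMeasure

variable {Ω : Type*} {m : MeasurableSpace Ω}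

/-- `llr` goes through `toReal`, so it determines the density only where that is neither `0` nor
`∞`; absolute continuity puts all the mass of `μ` there. -/
lemma ae_ofReal_exp_llr (μ ν : Measure Ω) [IsFiniteMeasure μ] [IsFiniteMeasure ν] (h : μ ≪ ν) :
    ∀ᵐ ω ∂μ, μ.rnDeriv ν ω ≠ 0 ∧ μ.rnDeriv ν ω ≠ ∞ ∧
      ENNReal.ofReal (Real.exp (llr μ ν ω)) = μ.rnDeriv ν ω := by
  filter_upwards [Measure.rnDeriv_pos h, h.ae_le (Measure.rnDeriv_lt_top μ ν)] with ω h0 h1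
  refine ⟨h0.ne', h1.ne, ?_⟩
  rw [llr, Real.exp_log (ENNReal.toReal_pos h0.ne' h1.ne), ENNReal.ofReal_toReal h1.ne]

lemma measure_inter_llr_lt_le (μ ν : Measure Ω) [IsFiniteMeasure μ] [IsFiniteMeasure ν]
    (h : μ ≪ ν) {F : Set Ω} (hF : MeasurableSet F) (x : ℝ) :
    μ (F ∩ {ω | llr μ ν ω < x}) ≤ ENNReal.ofReal (Real.exp x) * ν F := by
  set S : Set Ω := F ∩ {ω | μ.rnDeriv ν ω ≤ ENNReal.ofReal (Real.exp x)}
  have hS : MeasurableSet S :=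
    hF.inter (measurableSet_le (Measure.measurable_rnDeriv μ ν) measurable_const)
  calc μ (F ∩ {ω | llr μ ν ω < x}) ≤ μ S := by
        refine measure_mono_ae ?_
        filter_upwards [ae_ofReal_exp_llr μ ν h] with ω hω hx
        refine ⟨hx.1, ?_⟩
        have h2 : llr μ ν ω < x := hx.2
        change μ.rnDeriv ν ω ≤ _
        rw [← hω.2.2]
        exact ENNReal.ofReal_le_ofReal (Real.exp_le_exp.2 h2.le)
    _ = ∫⁻ ω in S, μ.rnDeriv ν ω ∂ν := (Measure.setLIntegral_rnDeriv h S).symm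
    _ ≤ ∫⁻ _ in S, ENNReal.ofReal (Real.exp x) ∂ν :=
        setLIntegral_mono measurable_const fun ω hω => hω.2
    _ = ENNReal.ofReal (Real.exp x) * ν S := setLIntegral_const _ _
    _ ≤ ENNReal.ofReal (Real.exp x) * ν F := by gcongr; exact Set.inter_subset_left

/-- Markov's inequality for the density, whose `ν`-integral is at most `1`. Positivity of `x`
excludes the points where the density is `0` or `∞`, at which `llr` takes the default value `0`. -/
lemma measure_le_llr_le (μ ν : Measure Ω) [IsProbabilityMeasure μ] [IsFiniteMeasure ν]
    {x : ℝ} (hx : 0 < x) :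
    ν {ω | x ≤ llr μ ν ω} ≤ ENNReal.ofReal (Real.exp (-x)) := by
  have h1 : ν {ω | x ≤ llr μ ν ω} ≤ ν {ω | ENNReal.ofReal (Real.exp x) ≤ μ.rnDeriv ν ω} := by
    refine measure_mono fun ω hω => ENNReal.ofReal_le_of_le_toReal ?_
    have hω' : x ≤ Real.log (μ.rnDeriv ν ω).toReal := hω
    have hpos : 0 < (μ.rnDeriv ν ω).toReal := by
      refine lt_of_le_of_ne ENNReal.toReal_nonneg fun h0 => ?_
      rw [← h0, Real.log_zero] at hω'
      linarith
    exact (Real.le_log_iff_exp_le hpos).1 hω'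
  have h2 := mul_meas_ge_le_lintegral (μ := ν) (Measure.measurable_rnDeriv μ ν)
    (ENNReal.ofReal (Real.exp x))
  have h3 : ∫⁻ ω, μ.rnDeriv ν ω ∂ν ≤ 1 :=
    (Measure.lintegral_rnDeriv_le).trans_eq measure_univ
  rw [Real.exp_neg, ENNReal.ofReal_inv_of_pos (Real.exp_pos x)]
  refine h1.trans (ENNReal.le_inv_iff_mul_le.2 ?_)
  rw [mul_comm]
  exact h2.trans h3

end ChangeOfMeasure

/-! ### Likelihood ratios, mixed statistics and information numbers of subsystems. -/

section Likelihood

variable {K : ℕ} {E : Fin K → Type*} [∀ k, MeasurableSpace (E k)]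

instance (P : Measure (Obs E)) [IsProbabilityMeasure P] (s : Finset (Fin K)) (n : ℕ) :
    IsProbabilityMeasure (marginalUpTo P s n) :=
  ⟨by rw [marginalUpTo, trim_measurableSet_eq _ MeasurableSet.univ, measure_univ]⟩

lemma marginalUpTo_apply (P : Measure (Obs E)) {s : Finset (Fin K)} {n : ℕ} {F : Set (Obs E)}
    (hF : MeasurableSet[sigmaUpTo E s n] F) : marginalUpTo P s n F = P F :=
  trim_measurableSet_eq _ hF

lemma sigmaUpTo_mono_left {s t : Finset (Fin K)} (h : s ⊆ t) (n : ℕ) :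
    sigmaUpTo E s n ≤ sigmaUpTo E t n :=
  iSup₂_mono fun _ _ => biSup_mono fun _ hk => h hk

lemma measurable_logLik (P Q : Measure (Obs E)) (s : Finset (Fin K)) (n : ℕ) :
    Measurable[sigmaUpTo E s n] (logLik P Q s n) :=
  measurable_llr _ _

lemma measure_inter_logLik_lt_le (P Q : Measure (Obs E)) [IsProbabilityMeasure P]
    [IsProbabilityMeasure Q] {s : Finset (Fin K)} {n : ℕ}
    (h : marginalUpTo P s n ≪ marginalUpTo Q s n) {F : Set (Obs E)}
    (hF : MeasurableSet[sigmaUpTo E s n] F) (x : ℝ) :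
    P (F ∩ {ω | logLik P Q s n ω < x}) ≤ ENNReal.ofReal (Real.exp x) * Q F := by
  have hm : MeasurableSet[sigmaUpTo E s n] {ω | logLik P Q s n ω < x} :=
    measurable_logLik P Q s n measurableSet_Iio
  rw [← marginalUpTo_apply Q hF, ← marginalUpTo_apply P (MeasurableSet.inter hF hm)]
  exact measure_inter_llr_lt_le _ _ h hF x

lemma measure_le_logLik_le (P Q : Measure (Obs E)) [IsProbabilityMeasure P]
    [IsProbabilityMeasure Q] (s : Finset (Fin K)) (n : ℕ) {x : ℝ} (hx : 0 < x) :
    Q {ω | x ≤ logLik P Q s n ω} ≤ ENNReal.ofReal (Real.exp (-x)) := by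
  have hm : MeasurableSet[sigmaUpTo E s n] {ω | x ≤ logLik P Q s n ω} :=
    measurable_logLik P Q s n measurableSet_Ici
  rw [← marginalUpTo_apply Q hm]
  exact measure_le_llr_le _ _ hx

lemma ae_lik_ne (P Q : Measure (Obs E)) [IsProbabilityMeasure P] [IsProbabilityMeasure Q]
    {s : Finset (Fin K)} {n : ℕ} (h : marginalUpTo P s n ≪ marginalUpTo Q s n) :
    ∀ᵐ ω ∂P, lik P Q s n ω ≠ 0 ∧ lik P Q s n ω ≠ ∞ ∧
      ENNReal.ofReal (Real.exp (logLik P Q s n ω)) = lik P Q s n ω :=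
  ae_of_ae_trim (sigmaUpTo_le s n) (ae_ofReal_exp_llr _ _ h)

lemma ae_lik_mul_lik (P Q R : Measure (Obs E)) [IsProbabilityMeasure P] [IsProbabilityMeasure Q]
    [IsProbabilityMeasure R] {s : Finset (Fin K)} {n : ℕ}
    (hPQ : marginalUpTo P s n ≪ marginalUpTo Q s n)
    (hPR : marginalUpTo P s n ≪ marginalUpTo R s n) :
    ∀ᵐ ω ∂P, lik P Q s n ω * lik Q R s n ω = lik P R s n ω :=
  ae_of_ae_trim (sigmaUpTo_le s n) (hPR.ae_le (Measure.rnDeriv_mul_rnDeriv hPQ))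

/-- Almost surely, a lower bound on the log-likelihood ratios of `P` against all the members of
`𝒬` is a lower bound on the mixed statistic of a family containing `P` against `𝒬`. -/
lemma ae_le_ratio {P R : Measure (Obs E)} [IsProbabilityMeasure P] [IsProbabilityMeasure R]
    {𝒢 𝒬 : Set (Measure (Obs E))} (hfin : 𝒬.Finite) (hprob : ∀ Q ∈ 𝒬, IsProbabilityMeasure Q)
    (hP : P ∈ 𝒢) {s : Finset (Fin K)} {n : ℕ}
    (hPR : marginalUpTo P s n ≪ marginalUpTo R s n)
    (hPQ : ∀ Q ∈ 𝒬, marginalUpTo P s n ≪ marginalUpTo Q s n) :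
    ∀ᵐ ω ∂P, ∀ x : ℝ, (∀ Q ∈ 𝒬, x ≤ logLik P Q s n ω) → ENNReal.ofReal (Real.exp x) ≤
      (⨆ P' ∈ 𝒢, lik P' R s n ω) / (⨆ Q ∈ 𝒬, lik Q R s n ω) := by
  have h1 : ∀ᵐ ω ∂P, ∀ Q ∈ 𝒬, lik P Q s n ω * lik Q R s n ω = lik P R s n ω ∧
      ENNReal.ofReal (Real.exp (logLik P Q s n ω)) = lik P Q s n ω := by
    refine (ae_ball_iff hfin.countable).2 fun Q hQ => ?_
    have := hprob Q hQ
    filter_upwards [ae_lik_mul_lik P Q R (hPQ Q hQ) hPR, ae_lik_ne P Q (hPQ Q hQ)] with ω h h'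
    exact ⟨h, h'.2.2⟩
  filter_upwards [h1, ae_lik_ne P R hPR] with ω hω hne x hx
  refine le_trans ?_ (ENNReal.div_le_div_right (le_iSup₂ (f := fun P' (_ : P' ∈ 𝒢) =>
    lik P' R s n ω) P hP) _)
  -- The numerator is a.s. neither `0` nor `∞`, so the division may be cleared even when `𝒬` is
  -- empty and the denominator is `0`.
  rw [ENNReal.le_div_iff_mul_le (Or.inr hne.1) (Or.inr hne.2.1), ENNReal.mul_iSup]
  simp_rw [ENNReal.mul_iSup]
  refine iSup₂_le fun Q hQ => ?_
  rw [← (hω Q hQ).1, ← (hω Q hQ).2]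
  gcongr
  exact hx Q hQ

/-- Almost surely, a lower bound on the log-likelihood ratios of `P` against all the members of
`𝒢` gives an upper bound on the mixed statistic of `𝒢` against a family containing `P`. -/
lemma ae_ratio_le {P R : Measure (Obs E)} [IsProbabilityMeasure P] [IsProbabilityMeasure R]
    {𝒢 𝒬 : Set (Measure (Obs E))} (hfin : 𝒢.Finite) (hprob : ∀ Q ∈ 𝒢, IsProbabilityMeasure Q)
    (hP : P ∈ 𝒬) {s : Finset (Fin K)} {n : ℕ}
    (hPR : marginalUpTo P s n ≪ marginalUpTo R s n)
    (hPG : ∀ Q ∈ 𝒢, marginalUpTo P s n ≪ marginalUpTo Q s n) :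
    ∀ᵐ ω ∂P, ∀ x : ℝ, (∀ Q ∈ 𝒢, x ≤ logLik P Q s n ω) →
      (⨆ P' ∈ 𝒢, lik P' R s n ω) / (⨆ Q ∈ 𝒬, lik Q R s n ω) ≤
        ENNReal.ofReal (Real.exp (-x)) := by
  have h1 : ∀ᵐ ω ∂P, ∀ Q ∈ 𝒢, lik P Q s n ω * lik Q R s n ω = lik P R s n ω ∧
      ENNReal.ofReal (Real.exp (logLik P Q s n ω)) = lik P Q s n ω := by
    refine (ae_ball_iff hfin.countable).2 fun Q hQ => ?_
    have := hprob Q hQ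
    filter_upwards [ae_lik_mul_lik P Q R (hPG Q hQ) hPR, ae_lik_ne P Q (hPG Q hQ)] with ω h h'
    exact ⟨h, h'.2.2⟩
  filter_upwards [h1] with ω hω x hx
  refine le_trans (ENNReal.div_le_div_left (le_iSup₂ (f := fun P' (_ : P' ∈ 𝒬) =>
    lik P' R s n ω) P hP) _) ?_
  refine ENNReal.div_le_of_le_mul (iSup₂_le fun Q hQ => ?_)
  calc lik Q R s n ω
      = ENNReal.ofReal (Real.exp (-x)) * (ENNReal.ofReal (Real.exp x) * lik Q R s n ω) := by
        rw [← mul_assoc, ← ENNReal.ofReal_mul (Real.exp_pos _).le, ← Real.exp_add]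
        simp
    _ ≤ ENNReal.ofReal (Real.exp (-x)) * lik P R s n ω := by
        rw [← (hω Q hQ).1, ← (hω Q hQ).2]
        gcongr
        exact hx Q hQ

/-! ### Information numbers -/

lemma isInfoNumber_info_of_exists {P Q : Measure (Obs E)} {s : Finset (Fin K)}
    (h : ∃ c, IsInfoNumber P Q s c) : IsInfoNumber P Q s (info P Q s) := by
  rw [info, dif_pos h]
  exact h.choose_spec

/-- The information number of a subsystem is at most that of a larger system. -/
lemma IsInfoNumber.mono {P Q : Measure (Obs E)} [IsProbabilityMeasure P] [IsProbabilityMeasure Q]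
    {s t : Finset (Fin K)} (hst : s ⊆ t) {c d : ℝ} (hc : IsInfoNumber P Q s c)
    (hd : IsInfoNumber P Q t d)
    (hAC : ∀ n, 1 ≤ n → marginalUpTo P t n ≪ marginalUpTo Q t n) : c ≤ d := by
  -- If `d < ρ < ρ' < c`, then under `P` typically `Z_n` is at least `nρ'` on `s` but below `nρ` on
  -- `t`. The former event has `Q`-probability at most `exp(-nρ')` and belongs to the σ-field of
  -- `t`, so a change of measure on `t` bounds the `P`-probability of both by `exp(-n(ρ' - ρ))`.
  by_contra! hlt
  obtain ⟨ρ, h1, h2⟩ := exists_between hlt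
  obtain ⟨ρ', h1', h2'⟩ := exists_between h2
  have hρ' : 0 < ρ' := by linarith [hd.pos]
  have ha := (hd.max_series ρ h1).comp (tendsto_add_atTop_nat 1)
  have hb := ENNReal.tendsto_atTop_zero_of_tsum_ne_top (hc.one_sided ρ' h2').ne
  have he : Tendsto (fun n : ℕ => ENNReal.ofReal (Real.exp (-((ρ' - ρ) * ((n + 1 : ℕ) : ℝ)))))
      atTop (𝓝 0) := by
    rw [← ENNReal.ofReal_zero]
    refine ENNReal.tendsto_ofReal (Real.tendsto_exp_neg_atTop_nhds_zero.comp ?_)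
    exact ((tendsto_natCast_atTop_atTop (R := ℝ)).comp
      (tendsto_add_atTop_nat 1)).const_mul_atTop (by linarith)
  have hab := (ha.add hb).add he
  rw [add_zero, add_zero] at hab
  refine absurd (ge_of_tendsto' hab fun n => ?_) (by simp : ¬ (1 : ℝ≥0∞) ≤ 0)
  set x : ℝ := ((n + 1 : ℕ) : ℝ)
  have hx : 0 < x := by positivity
  set F : Set (Obs E) := {ω | x * ρ' ≤ logLik P Q s (n + 1) ω}
  have hF : MeasurableSet[sigmaUpTo E t (n + 1)] F :=
    sigmaUpTo_mono_left hst _ _ (measurable_logLik P Q s (n + 1) measurableSet_Ici)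
  have hkey : P (F ∩ {ω | logLik P Q t (n + 1) ω < x * ρ}) ≤
      ENNReal.ofReal (Real.exp (-((ρ' - ρ) * x))) := by
    refine (measure_inter_logLik_lt_le P Q (hAC _ (by omega)) hF _).trans ?_
    refine (mul_le_mul_right (measure_le_logLik_le P Q s (n + 1) (by positivity)) _).trans_eq ?_
    rw [← ENNReal.ofReal_mul (Real.exp_pos _).le, ← Real.exp_add]
    congr 2
    ring
  calc (1 : ℝ≥0∞) = P Set.univ := measure_univ.symm
    _ ≤ P (({ω | ∃ m : ℕ, 1 ≤ m ∧ m ≤ n + 1 ∧ x * ρ ≤ logLik P Q t m ω} ∪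
          {ω | logLik P Q s (n + 1) ω < x * ρ'}) ∪
          (F ∩ {ω | logLik P Q t (n + 1) ω < x * ρ})) := by
        refine measure_mono fun ω _ => ?_
        rcases lt_or_ge (logLik P Q s (n + 1) ω) (x * ρ') with h | h
        · exact Or.inl (Or.inr h)
        rcases lt_or_ge (logLik P Q t (n + 1) ω) (x * ρ) with h' | h'
        · exact Or.inr ⟨h, h'⟩
        · exact Or.inl (Or.inl ⟨n + 1, by omega, le_rfl, h'⟩)
    _ ≤ _ := (measure_union_le _ _).trans (add_le_add (measure_union_le _ _) hkey)

end Likelihood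

/-! ### Lower bounds on the expected sample size. -/

section LowerBound

variable {K : ℕ} {E : Fin K → Type*} [∀ k, MeasurableSpace (E k)] {S : Problem K E}

lemma IsLevelSeq.tendsto_abs_log {a : ℕ → ℝ} (ha : IsLevelSeq a) :
    Tendsto (fun i => |Real.log (a i)|) atTop atTop := by
  have h : Tendsto a atTop (𝓝[>] 0) :=
    tendsto_nhdsWithin_iff.2 ⟨ha.2, Eventually.of_forall fun i => (ha.1 i).1⟩
  exact tendsto_abs_atBot_atTop.comp (Real.tendsto_log_nhdsGT_zero.comp h)

lemma IsLevelSeq.exp_neg_abs_log {a : ℕ → ℝ} (ha : IsLevelSeq a) (i : ℕ) :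
    Real.exp (-|Real.log (a i)|) = a i := by
  rw [abs_of_neg (Real.log_neg (ha.1 i).1 (ha.1 i).2), neg_neg, Real.exp_log (ha.1 i).1]

/-- A test that stops early has to separate `P` from `Q` with few observations. -/
lemma Problem.IsTest.measure_le_le {T : Obs E → ℕ∞} {D : Obs E → Finset (Finset (Fin K))}
    (hT : S.IsTest T D) (p : Finset (Finset (Fin K)) → Prop) {P Q : Measure (Obs E)}
    [IsProbabilityMeasure P] [IsProbabilityMeasure Q]
    (hAC : ∀ n, 1 ≤ n → marginalUpTo P Finset.univ n ≪ marginalUpTo Q Finset.univ n)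
    {a b : ℝ≥0∞} (hQ : Q {ω | T ω < ⊤ ∧ p (D ω)} ≤ a) (hP : P {ω | T ω < ⊤ ∧ ¬ p (D ω)} ≤ b)
    (n : ℕ) (x : ℝ) :
    P {ω | T ω ≤ n} ≤ b + ENNReal.ofReal (Real.exp x) * a +
      P {ω | ∃ m : ℕ, 1 ≤ m ∧ m ≤ n ∧ x ≤ logLik P Q Finset.univ m ω} := by
  set F : ℕ → Set (Obs E) := fun m => {ω | T ω = m ∧ p (D ω)}
  have hF : ∀ m, 1 ≤ m → MeasurableSet[sigmaUpTo E Finset.univ m] (F m) := by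
    intro m hm
    -- Measurability of a test is given one decision at a time; there are only finitely many sets of
    -- units.
    have : F m = ⋃ A ∈ {A | A ∈ S.Psi ∧ p A}, {ω | T ω = m ∧ D ω = A} := by
      ext ω
      simp only [F, Set.mem_ofPred_eq, Set.mem_iUnion, exists_prop]
      exact ⟨fun h => ⟨D ω, ⟨hT.mem_Psi ω, h.2⟩, h.1, rfl⟩, fun ⟨A, h, h1, h2⟩ =>
        ⟨h1, h2 ▸ h.2⟩⟩
    rw [this]
    exact MeasurableSet.biUnion (Set.to_countable _) fun A hA => hT.measurable m hm A hA.1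
  have hF' : ∀ m ∈ Finset.Icc 1 n, MeasurableSet (F m) := fun m hm =>
    sigmaUpTo_le _ _ _ (hF m (Finset.mem_Icc.1 hm).1)
  have hsub : {ω | T ω ≤ n} ⊆ ({ω | T ω < ⊤ ∧ ¬ p (D ω)} ∪
      ⋃ m ∈ Finset.Icc 1 n, F m ∩ {ω | logLik P Q Finset.univ m ω < x}) ∪
      {ω | ∃ m : ℕ, 1 ≤ m ∧ m ≤ n ∧ x ≤ logLik P Q Finset.univ m ω} := by
    intro ω hω
    have hω : T ω ≤ n := hω
    have hlt : T ω < ⊤ := hω.trans_lt (ENat.natCast_lt_top n)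
    by_cases hp : p (D ω)
    · obtain ⟨m, hm⟩ := ENat.ne_top_iff_exists.1 hlt.ne
      have h1 : 1 ≤ m := by
        have := hT.one_le ω
        rw [← hm] at this
        exact_mod_cast this
      have h2 : m ≤ n := by
        rw [← hm] at hω
        exact_mod_cast hω
      rcases lt_or_ge (logLik P Q Finset.univ m ω) x with h | h
      · refine Or.inl (Or.inr (Set.mem_iUnion₂.2 ⟨m, Finset.mem_Icc.2 ⟨h1, h2⟩, ⟨hm.symm, hp⟩, h⟩))
      · exact Or.inr ⟨m, h1, h2, h⟩
    · exact Or.inl (Or.inl ⟨hlt, hp⟩)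
  have hdisj : Set.PairwiseDisjoint (↑(Finset.Icc 1 n)) F := by
    intro m _ m' _ hne
    refine Set.disjoint_left.2 fun ω h h' => hne ?_
    have h3 : (m : ℕ∞) = m' := h.1.symm.trans h'.1
    exact_mod_cast h3
  have hmid : P (⋃ m ∈ Finset.Icc 1 n, F m ∩ {ω | logLik P Q Finset.univ m ω < x}) ≤
      ENNReal.ofReal (Real.exp x) * a := by
    calc _ ≤ ∑ m ∈ Finset.Icc 1 n, P (F m ∩ {ω | logLik P Q Finset.univ m ω < x}) :=
          measure_biUnion_finset_le _ _
      _ ≤ ∑ m ∈ Finset.Icc 1 n, ENNReal.ofReal (Real.exp x) * Q (F m) :=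
          Finset.sum_le_sum fun m hm => measure_inter_logLik_lt_le P Q
            (hAC m (Finset.mem_Icc.1 hm).1) (hF m (Finset.mem_Icc.1 hm).1) x
      -- The events for different stopping times are disjoint, so the error probability under `Q` is
      -- paid once and not `n` times.
      _ = ENNReal.ofReal (Real.exp x) * Q (⋃ m ∈ Finset.Icc 1 n, F m) := by
          rw [← Finset.mul_sum, measure_biUnion_finset hdisj hF']
      _ ≤ _ := by
          gcongr
          refine le_trans (measure_mono ?_) hQ
          refine Set.iUnion₂_subset fun m _ ω hω => ⟨?_, hω.2⟩
          rw [hω.1]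
          exact ENat.natCast_lt_top m
  exact (measure_mono hsub).trans ((measure_union_le _ _).trans
    (add_le_add_left ((measure_union_le _ _).trans (add_le_add hP hmid)) _))

lemma Problem.IsTest.mul_le_expTime {T : Obs E → ℕ∞} {D : Obs E → Finset (Finset (Fin K))}
    (hT : S.IsTest T D) (P : Measure (Obs E)) [IsProbabilityMeasure P] (n : ℕ) {η : ℝ≥0∞}
    (hη : P {ω | T ω ≤ n} ≤ η) : (n : ℝ≥0∞) * (1 - η) ≤ expTime P T := by
  have hm : MeasurableSet {ω | T ω ≤ n} := sigmaUpTo_le _ _ _ (hT.stopping n)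
  calc (n : ℝ≥0∞) * (1 - η) ≤ n * (1 - P {ω | T ω ≤ n}) := by gcongr
    _ = n * P {ω | T ω ≤ n}ᶜ := by rw [prob_compl_eq_one_sub hm]
    _ = ∫⁻ ω, {ω | T ω ≤ n}ᶜ.indicator (fun _ => (n : ℝ≥0∞)) ω ∂P :=
        (lintegral_indicator_const hm.compl _).symm
    _ ≤ expTime P T := by
        refine lintegral_mono fun ω => ?_
        refine Set.indicator_apply_le' (fun h => ?_) fun _ => zero_le
        have hn : ¬ T ω ≤ n := h
        have := ENat.toENNReal_le.2 (not_le.1 hn).le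
        simpa using this

/-- Asymptotic lower bound on the expected sample size of tests that distinguish `P` from `Q`. -/
lemma eventually_le_optTime {𝒞 : ℕ → Set (Problem.Pair E)} {a b : ℕ → ℝ} (ha : IsLevelSeq a)
    (hb : IsLevelSeq b) {P Q : Measure (Obs E)} [IsProbabilityMeasure P] [IsProbabilityMeasure Q]
    (hAC : ∀ n, 1 ≤ n → marginalUpTo P Finset.univ n ≪ marginalUpTo Q Finset.univ n)
    {c : ℝ} (hc : IsInfoNumber P Q Finset.univ c) (p : Finset (Finset (Fin K)) → Prop)
    (h𝒞 : ∀ i, ∀ χ ∈ 𝒞 i, S.IsTest χ.1 χ.2 ∧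
      Q {ω | χ.1 ω < ⊤ ∧ p (χ.2 ω)} ≤ ENNReal.ofReal (a i) ∧
      P {ω | χ.1 ω < ⊤ ∧ ¬ p (χ.2 ω)} ≤ ENNReal.ofReal (b i))
    {r : ℝ} (hr : c < r) :
    ∀ᶠ i in atTop, ENNReal.ofReal (|Real.log (a i)| / r) ≤ optTime P (𝒞 i) := by
  -- In `c < ρ < r' < r` with `n ≈ |log a| / r'`: `c < ρ` makes the maximal term vanish, `ρ < r'`
  -- makes `exp(nρ) a` vanish, and `r' < r` absorbs the factor `1 - η` and the rounding.
  obtain ⟨ρ, hcρ, hρr⟩ := exists_between hr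
  obtain ⟨r', hρr', hr'r⟩ := exists_between hρr
  have hρ : 0 < ρ := hc.pos.trans hcρ
  have hr' : 0 < r' := hρ.trans hρr'
  have hr0 : 0 < r := hr'.trans hr'r
  set L : ℕ → ℝ := fun i => |Real.log (a i)|
  have hL : Tendsto L atTop atTop := ha.tendsto_abs_log
  set n : ℕ → ℕ := fun i => ⌊r'⁻¹ * L i⌋₊
  have hn : Tendsto n atTop atTop :=
    tendsto_nat_floor_atTop.comp (hL.const_mul_atTop (inv_pos.2 hr'))
  have hnL : Tendsto (fun i => (n i : ℝ) / L i) atTop (𝓝 r'⁻¹) :=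
    (tendsto_nat_floor_mul_div_atTop (inv_pos.2 hr').le).comp hL
  have h1 : Tendsto (fun i => ENNReal.ofReal (b i)) atTop (𝓝 0) := by
    simpa using ENNReal.tendsto_ofReal hb.2
  have h2 : Tendsto (fun i => ENNReal.ofReal (Real.exp (n i * ρ)) * ENNReal.ofReal (a i)) atTop
      (𝓝 0) := by
    have h3 : Tendsto (fun i => ENNReal.ofReal (Real.exp (-((1 - r'⁻¹ * ρ) * L i)))) atTop
        (𝓝 0) := by
      rw [← ENNReal.ofReal_zero]
      refine ENNReal.tendsto_ofReal (Real.tendsto_exp_neg_atTop_nhds_zero.comp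
        (hL.const_mul_atTop ?_))
      rw [sub_pos, inv_mul_lt_iff₀ hr']
      linarith
    refine tendsto_of_tendsto_of_tendsto_of_le_of_le tendsto_const_nhds h3
      (fun _ => zero_le) fun i => ?_
    rw [← ENNReal.ofReal_mul (Real.exp_pos _).le, ← ha.exp_neg_abs_log i, ← Real.exp_add]
    refine ENNReal.ofReal_le_ofReal (Real.exp_le_exp.2 ?_)
    have h4 : (n i : ℝ) ≤ r'⁻¹ * L i :=
      Nat.floor_le (mul_nonneg (inv_pos.2 hr').le (abs_nonneg _))
    have h5 := mul_le_mul_of_nonneg_right h4 hρ.le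
    change (n i : ℝ) * ρ + -L i ≤ _
    linarith
  have h3 := (hc.max_series ρ hcρ).comp hn
  have hη := (h1.add h2).add h3
  rw [add_zero, add_zero] at hη
  set η : ℕ → ℝ≥0∞ := fun i => ENNReal.ofReal (b i) +
    ENNReal.ofReal (Real.exp (n i * ρ)) * ENNReal.ofReal (a i) +
    P {ω | ∃ m : ℕ, 1 ≤ m ∧ m ≤ n i ∧ (n i : ℝ) * ρ ≤ logLik P Q Finset.univ m ω}
  have hη : Tendsto η atTop (𝓝 0) := hη
  have hlim : Tendsto (fun i => ENNReal.ofReal (n i / L i) * (1 - η i)) atTop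
      (𝓝 (ENNReal.ofReal r'⁻¹ * (1 - 0))) :=
    ENNReal.Tendsto.mul (ENNReal.tendsto_ofReal hnL) (Or.inr (by simp))
      (ENNReal.Tendsto.sub tendsto_const_nhds hη (Or.inl ENNReal.one_ne_top)) (Or.inr (by simp))
  have hlt : ENNReal.ofReal r⁻¹ < ENNReal.ofReal r'⁻¹ * (1 - 0) := by
    rw [tsub_zero, mul_one, ENNReal.ofReal_lt_ofReal_iff (inv_pos.2 hr')]
    exact inv_strictAnti₀ hr' hr'r
  filter_upwards [hlim.eventually (lt_mem_nhds hlt), hL.eventually_gt_atTop 0] with i hi hLi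
  refine le_iInf₂ fun χ hχ => ?_
  obtain ⟨hT, hQ, hP⟩ := h𝒞 i χ hχ
  refine le_trans ?_ (hT.mul_le_expTime P (n i) (hT.measure_le_le p hAC hQ hP (n i) (n i * ρ)))
  calc ENNReal.ofReal (L i / r) = ENNReal.ofReal (L i) * ENNReal.ofReal r⁻¹ := by
        rw [← ENNReal.ofReal_mul hLi.le, div_eq_mul_inv]
    _ ≤ ENNReal.ofReal (L i) * (ENNReal.ofReal (n i / L i) * (1 - η i)) := by gcongr
    _ = n i * (1 - η i) := by
        rw [← mul_assoc, ← ENNReal.ofReal_mul hLi.le, mul_div_cancel₀ _ hLi.ne',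
          ENNReal.ofReal_natCast]

end LowerBound

/-! ### Upper bounds on the expected sample size of the proposed tests. -/

section UpperBound

lemma firstTime_le {p : ℕ → Prop} {n : ℕ} (hn : 1 ≤ n) (h : p n) : firstTime p ≤ n :=
  iInf₂_le (f := fun (n : ℕ) (_ : n ∈ {n : ℕ | 1 ≤ n ∧ p n}) => (n : ℕ∞)) n ⟨hn, h⟩

lemma tsum_measure_biUnion_lt_top {Ω ι : Type*} {m : MeasurableSpace Ω} (P : Measure Ω)
    {I : Set ι} (hI : I.Finite) {f : ι → ℕ → Set Ω} (h : ∀ i ∈ I, ∑' n, P (f i n) < ∞) :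
    ∑' n, P (⋃ i ∈ I, f i n) < ∞ := by
  lift I to Finset ι using hI
  calc ∑' n, P (⋃ i ∈ (I : Set ι), f i n) ≤ ∑' n, ∑ i ∈ I, P (f i n) :=
        ENNReal.tsum_le_tsum fun n => measure_biUnion_finset_le I _
    _ = ∑ i ∈ I, ∑' n, P (f i n) := Summable.tsum_finsetSum fun _ _ => ENNReal.summable
    _ < ∞ := ENNReal.sum_lt_top.2 h

lemma exists_pos_forall_lt {ι : Type*} {I : Set ι} (hI : I.Finite) {f : ι → ℝ}
    (h : ∀ i ∈ I, 0 < f i) : ∃ ρ, 0 < ρ ∧ ∀ i ∈ I, ρ < f i := by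
  have : ∀ᶠ ρ in 𝓝[>] (0 : ℝ), 0 < ρ ∧ ∀ i ∈ I, ρ < f i :=
    (eventually_mem_nhdsWithin).and ((eventually_all_finite hI).2 fun i hi =>
      nhdsWithin_le_nhds (gt_mem_nhds (h i hi)))
  exact this.exists

variable {K : ℕ} {E : Fin K → Type*} [∀ k, MeasurableSpace (E k)]

/-- If `T ≤ n` off `bad n` for all `n ≥ N`, then `E[T]` exceeds `N + 1` by at most
`∑ P(bad n)`. -/
lemma expTime_le (P : Measure (Obs E)) [IsProbabilityMeasure P] {T : Obs E → ℕ∞}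
    {bad : ℕ → Set (Obs E)} {N : ℕ}
    (h : ∀ᵐ ω ∂P, ∀ n, 1 ≤ n → N ≤ n → ω ∉ bad n → T ω ≤ n) :
    expTime P T ≤ N + 1 + ∑' n, P (bad (n + 1)) := by
  -- The bad sets need not be measurable; measurable hulls have the same measure. `M n` belongs to
  -- time `n + 1`.
  set M : ℕ → Set (Obs E) := fun n => toMeasurable P (bad (n + 1))
  have hM : ∀ n, MeasurableSet (M n) := fun n => measurableSet_toMeasurable _ _
  calc expTime P T
      ≤ ∫⁻ ω, ((N + 1 : ℕ) : ℝ≥0∞) + ∑' n, (M n).indicator 1 ω ∂P := by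
        refine lintegral_mono_ae ?_
        filter_upwards [h] with ω hω
        -- At the first index `N + j` outside the hulls, `T ≤ N + j + 1`, and the `j` preceding
        -- indices have each contributed `1` to the sum. If there is no such index the sum is
        -- infinite.
        have key : ∀ j : ℕ, (T ω : ℝ≥0∞) ≤ ((N + 1 : ℕ) : ℝ≥0∞) + ∑' n, (M n).indicator 1 ω ∨
            ∀ n, N ≤ n → n < N + j → ω ∈ M n := by
          intro j
          induction j with
          | zero => exact Or.inr fun n h1 h2 => absurd h2 (by omega)
          | succ j ih =>
            rcases ih with ih | ih
            · exact Or.inl ih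
            by_cases hj : ω ∈ M (N + j)
            · refine Or.inr fun n h1 h2 => ?_
              rcases Nat.lt_succ_iff_lt_or_eq.1 h2 with h3 | h3
              · exact ih n h1 h3
              · exact h3 ▸ hj
            · left
              have h1 : T ω ≤ (N + j + 1 : ℕ) := hω _ (by omega) (by omega)
                fun hb => hj (subset_toMeasurable _ _ hb)
              have h2 : (T ω : ℝ≥0∞) ≤ ((N + j + 1 : ℕ) : ℝ≥0∞) := by
                simpa using ENat.toENNReal_le.2 h1
              refine h2.trans ?_
              have h3 : (j : ℝ≥0∞) ≤ ∑' n, (M n).indicator 1 ω := by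
                refine le_trans ?_ (ENNReal.sum_le_tsum (Finset.Ico N (N + j)))
                rw [Finset.sum_congr rfl fun n hn => Set.indicator_of_mem
                  (ih n (Finset.mem_Ico.1 hn).1 (Finset.mem_Ico.1 hn).2) _]
                simp
              calc ((N + j + 1 : ℕ) : ℝ≥0∞) = ((N + 1 : ℕ) : ℝ≥0∞) + j := by
                    push_cast; ring
                _ ≤ _ := by gcongr
        by_cases hT : (T ω : ℝ≥0∞) ≤ ((N + 1 : ℕ) : ℝ≥0∞) + ∑' n, (M n).indicator 1 ω
        · exact hT
        have hall : ∀ n, N ≤ n → ω ∈ M n := fun n hn =>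
          ((key (n + 1 - N)).resolve_left hT) n hn (by omega)
        have htop : ∑' n, (M n).indicator (1 : Obs E → ℝ≥0∞) ω = ∞ := by
          refine ENNReal.eq_top_of_forall_nnreal_le fun r => ?_
          obtain ⟨j, hj⟩ := exists_nat_ge r
          refine le_trans (ENNReal.coe_le_coe.2 hj) ?_
          refine le_trans ?_ (ENNReal.sum_le_tsum (Finset.Ico N (N + j)))
          rw [Finset.sum_congr rfl fun n hn => Set.indicator_of_mem
            (hall n (Finset.mem_Ico.1 hn).1) _]
          simp
        rw [htop]
        simp
    _ = ((N + 1 : ℕ) : ℝ≥0∞) + ∑' n, P (M n) := by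
        rw [lintegral_add_left measurable_const, lintegral_const, measure_univ, mul_one,
          lintegral_tsum fun n => (measurable_one.indicator (hM n)).aemeasurable]
        simp_rw [lintegral_indicator_one (hM _)]
    _ = _ := by simp [M, measure_toMeasurable]

variable {S : Problem K E}

lemma Problem.distsPsi_finite (S : Problem K E) : S.distsPsi.Finite :=
  S.dists_finite.subset fun _ h => h.1

lemma Problem.globalNull_finite (S : Problem K E) : S.globalNull.Finite :=
  S.dists_finite.subset fun _ h => h.1

lemma Problem.altAt_finite (S : Problem K E) (e : Finset (Fin K)) : (S.altAt e).Finite :=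
  S.distsPsi_finite.subset fun _ h => h.1

lemma Problem.nullAt_finite (S : Problem K E) (e : Finset (Fin K)) : (S.nullAt e).Finite :=
  S.distsPsi_finite.subset fun _ h => h.1.1

lemma Problem.signals_subset_units (S : Problem K E) (P : Measure (Obs E)) :
    S.signals P ⊆ S.units := by
  classical exact Finset.filter_subset _ _

lemma Problem.signals_of_mem_globalNull {P : Measure (Obs E)} (h : P ∈ S.globalNull) :
    S.signals P = ∅ := h.2.2

lemma Problem.signals_nonempty {P : Measure (Obs E)} (h : P ∈ S.distsPsi \ S.globalNull) :
    (S.signals P).Nonempty := by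
  rw [Finset.nonempty_iff_ne_empty]
  exact fun h0 => h.2 ⟨h.1.1, h.1.2.1, h0⟩

lemma Subsystems.globalNull_nonempty (σ : Subsystems S) {P : Measure (Obs E)}
    (h : P ∈ S.distsPsi \ S.globalNull) : S.globalNull.Nonempty := by
  obtain ⟨e, he⟩ := S.signals_nonempty h
  exact ⟨_, σ.refDet_mem e (S.signals_subset_units P he)⟩

variable (σ : Subsystems S) {P : Measure (Obs E)}

lemma Subsystems.ae_le_LamDet (hAC : S.MutuallyAC) (hP : P ∈ S.distsPsi) {e : Finset (Fin K)}
    (he : e ∈ S.signals P) :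
    ∀ᵐ ω ∂P, ∀ n, 1 ≤ n → ∀ x : ℝ, (∀ Q ∈ S.globalNull, x ≤ logLik P Q (σ.det e) n ω) →
      ENNReal.ofReal (Real.exp x) ≤ σ.LamDet e n ω := by
  have hu := S.signals_subset_units P he
  have := S.dists_prob P hP.1
  have := S.dists_prob _ (σ.refDet_mem e hu).1
  refine ae_all_iff.2 fun n => eventually_imp_distrib_left.2 fun hn => ?_
  have h : ∀ Q ∈ S.globalNull, marginalUpTo P (σ.det e) n ≪ marginalUpTo Q (σ.det e) n :=
    fun Q hQ => (hAC e hu P (Or.inl ⟨hP, he⟩) Q (Or.inr hQ) _ (σ.subset_det e hu) n hn).1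
  exact ae_le_ratio S.globalNull_finite (fun Q hQ => S.dists_prob Q hQ.1)
    (show P ∈ S.altAt e from ⟨hP, he⟩) (h _ (σ.refDet_mem e hu)) h

lemma Subsystems.ae_le_LamIso (hAC : S.MutuallyAC) (hP : P ∈ S.distsPsi) {e : Finset (Fin K)}
    (he : e ∈ S.signals P) :
    ∀ᵐ ω ∂P, ∀ n, 1 ≤ n → ∀ x : ℝ, (∀ Q ∈ S.nullAt e, x ≤ logLik P Q (σ.iso e) n ω) →
      ENNReal.ofReal (Real.exp x) ≤ σ.LamIso e n ω := by
  have hu := S.signals_subset_units P he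
  have := S.dists_prob P hP.1
  have := S.dists_prob _ (σ.refIso_mem e hu).1
  refine ae_all_iff.2 fun n => eventually_imp_distrib_left.2 fun hn => ?_
  have h : ∀ Q ∈ S.nullAt e ∪ S.globalNull,
      marginalUpTo P (σ.iso e) n ≪ marginalUpTo Q (σ.iso e) n :=
    fun Q hQ => (hAC e hu P (Or.inl ⟨hP, he⟩) Q hQ _ (σ.subset_iso e hu) n hn).1
  exact ae_le_ratio (S.nullAt_finite e) (fun Q hQ => S.dists_prob Q hQ.1.1.1)
    (show P ∈ S.altAt e from ⟨hP, he⟩) (h _ (Or.inr (σ.refIso_mem e hu)))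
    fun Q hQ => h Q (Or.inl hQ)

lemma Subsystems.ae_LamIso_le (hAC : S.MutuallyAC) (hP : P ∈ S.distsPsi \ S.globalNull)
    {e : Finset (Fin K)} (hu : e ∈ S.units) (he : e ∉ S.signals P) :
    ∀ᵐ ω ∂P, ∀ n, 1 ≤ n → ∀ x : ℝ, (∀ Q ∈ S.altAt e, x ≤ logLik P Q (σ.iso e) n ω) →
      σ.LamIso e n ω ≤ ENNReal.ofReal (Real.exp (-x)) := by
  have := S.dists_prob P hP.1.1
  have := S.dists_prob _ (σ.refIso_mem e hu).1
  refine ae_all_iff.2 fun n => eventually_imp_distrib_left.2 fun hn => ?_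
  have h : ∀ Q ∈ S.altAt e ∪ S.globalNull,
      marginalUpTo P (σ.iso e) n ≪ marginalUpTo Q (σ.iso e) n :=
    fun Q hQ => (hAC e hu Q hQ P (Or.inl ⟨hP, he⟩) _ (σ.subset_iso e hu) n hn).2
  exact ae_ratio_le (S.altAt_finite e) (fun Q hQ => S.dists_prob Q hQ.1.1)
    (show P ∈ S.nullAt e from ⟨hP, he⟩) (h _ (Or.inr (σ.refIso_mem e hu)))
    fun Q hQ => h Q (Or.inl hQ)

lemma tsum_measure_logLik_lt (P : Measure (Obs E)) {𝒬 : Set (Measure (Obs E))}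
    (hfin : 𝒬.Finite) {s : Finset (Fin K)} (h : ∀ Q ∈ 𝒬, ∃ c, IsInfoNumber P Q s c) {ρ : ℝ}
    (hρ : ∀ Q ∈ 𝒬, ρ < info P Q s) :
    ∑' n : ℕ, P (⋃ Q ∈ 𝒬, {ω | logLik P Q s (n + 1) ω < ((n + 1 : ℕ) : ℝ) * ρ}) < ∞ :=
  tsum_measure_biUnion_lt_top P hfin (f := fun Q n =>
    {ω | logLik P Q s (n + 1) ω < ((n + 1 : ℕ) : ℝ) * ρ}) fun Q hQ =>
    (isInfoNumber_info_of_exists (h Q hQ)).one_sided ρ (hρ Q hQ)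

lemma ofReal_le_exp_of_log_le {x y : ℝ} (hx : 0 < x) (h : Real.log x ≤ y) :
    ENNReal.ofReal x ≤ ENNReal.ofReal (Real.exp y) :=
  ENNReal.ofReal_le_ofReal ((Real.log_le_iff_le_exp hx).1 h)

/-- The acceptance time `T0` can only shorten sampling, so it suffices to follow the one unit `e`.
The constant is chosen before the thresholds, which makes it negligible in the limit. -/
lemma Subsystems.exists_expTime_TstarDet_le (hAC : S.MutuallyAC) (hInfo : S.HasInfoNumbers)
    (hP : P ∈ S.distsPsi) {e : Finset (Fin K)} (he : e ∈ S.signals P) {ρ : ℝ} (hρ0 : 0 < ρ)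
    (hρ : ∀ Q ∈ S.globalNull, ρ < info P Q (σ.det e)) :
    ∃ c < ∞, ∀ (C D : Finset (Fin K) → ℝ) (N : ℕ), 0 < D e → Real.log (D e) ≤ N * ρ →
      expTime P (σ.TstarDet C D) ≤ N + 1 + c := by
  have hu := S.signals_subset_units P he
  have := S.dists_prob P hP.1
  refine ⟨_, tsum_measure_logLik_lt P S.globalNull_finite (fun Q hQ =>
    (hInfo e hu P ⟨hP, he⟩ Q (Or.inr hQ) _ (σ.subset_det e hu)).1) hρ, fun C D N hD hN => ?_⟩
  refine expTime_le P (bad := fun n => ⋃ Q ∈ S.globalNull,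
    {ω | logLik P Q (σ.det e) n ω < (n : ℝ) * ρ}) ?_
  filter_upwards [σ.ae_le_LamDet hAC hP he] with ω hω n hn hNn hbad
  simp only [Set.mem_iUnion, Set.mem_ofPred_eq, not_exists, not_lt] at hbad
  refine (min_le_right _ _).trans (firstTime_le hn ⟨e, hu, ?_⟩)
  refine le_trans (ofReal_le_exp_of_log_le hD (hN.trans ?_)) (hω n hn (n * ρ) hbad)
  gcongr

/-- Three kinds of bad event have summable probabilities: slow growth of the detection statistic of
`e₀`, slow growth of the isolation statistic of a signal, and slow decay of that of a non-signal.
Off them, every condition in `Tjoint` holds from time `N` on. -/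
lemma Subsystems.exists_expTime_Tstar_le (hAC : S.MutuallyAC) (hInfo : S.HasInfoNumbers)
    (hP : P ∈ S.distsPsi \ S.globalNull) {e₀ : Finset (Fin K)} (he₀ : e₀ ∈ S.signals P)
    {ρ ρ₁ ρ₂ : ℝ} (hρ0 : 0 < ρ) (hρ₁0 : 0 < ρ₁) (hρ₂0 : 0 < ρ₂)
    (hρ : ∀ Q ∈ S.globalNull, ρ < info P Q (σ.det e₀))
    (hρ₁ : ∀ e ∈ S.signals P, ∀ Q ∈ S.nullAt e, ρ₁ < info P Q (σ.iso e))
    (hρ₂ : ∀ e ∈ S.units, e ∉ S.signals P → ∀ Q ∈ S.altAt e, ρ₂ < info P Q (σ.iso e)) :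
    ∃ c < ∞, ∀ (A B C D : Finset (Fin K) → ℝ) (N : ℕ),
      (∀ e ∈ S.units, 0 < A e ∧ 0 < B e ∧ 0 < D e) → Real.log (D e₀) ≤ N * ρ →
      (∀ e ∈ S.signals P, Real.log (B e) ≤ N * ρ₁) → (∀ e ∈ S.units, Real.log (A e) ≤ N * ρ₂) →
      expTime P (σ.Tstar A B C D) ≤ N + 1 + c := by
  have hsu := S.signals_subset_units P
  have := S.dists_prob P hP.1.1
  have h0 := tsum_measure_logLik_lt P S.globalNull_finite (fun Q hQ =>
    (hInfo e₀ (hsu he₀) P ⟨hP.1, he₀⟩ Q (Or.inr hQ) _ (σ.subset_det e₀ (hsu he₀))).1) hρ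
  have h1 := tsum_measure_biUnion_lt_top P (S.signals P).finite_toSet (f := fun e n =>
    ⋃ Q ∈ S.nullAt e, {ω | logLik P Q (σ.iso e) (n + 1) ω < ((n + 1 : ℕ) : ℝ) * ρ₁}) fun e he =>
    tsum_measure_logLik_lt P (S.nullAt_finite e) (fun Q hQ =>
      (hInfo e (hsu he) P ⟨hP.1, he⟩ Q (Or.inl hQ) _ (σ.subset_iso e (hsu he))).1) (hρ₁ e he)
  have h2 := tsum_measure_biUnion_lt_top P (S.units.finite_toSet.sep (· ∉ S.signals P))
    (f := fun e n =>
    ⋃ Q ∈ S.altAt e, {ω | logLik P Q (σ.iso e) (n + 1) ω < ((n + 1 : ℕ) : ℝ) * ρ₂}) fun e he =>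
    tsum_measure_logLik_lt P (S.altAt_finite e) (fun Q hQ =>
      (hInfo e he.1 Q hQ P (Or.inl ⟨hP, he.2⟩) _ (σ.subset_iso e he.1)).2) (hρ₂ e he.1 he.2)
  refine ⟨_, ENNReal.add_lt_top.2 ⟨ENNReal.add_lt_top.2 ⟨h0, h1⟩, h2⟩,
    fun A B C D N hpos hD hB hA => ?_⟩
  rw [← ENNReal.tsum_add, ← ENNReal.tsum_add]
  refine le_trans (expTime_le P (N := N) (bad := fun n =>
    ((⋃ Q ∈ S.globalNull, {ω | logLik P Q (σ.det e₀) n ω < (n : ℝ) * ρ}) ∪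
      (⋃ e ∈ (S.signals P : Set _), ⋃ Q ∈ S.nullAt e,
        {ω | logLik P Q (σ.iso e) n ω < (n : ℝ) * ρ₁})) ∪
      (⋃ e ∈ {e ∈ (S.units : Set _) | e ∉ S.signals P}, ⋃ Q ∈ S.altAt e,
        {ω | logLik P Q (σ.iso e) n ω < (n : ℝ) * ρ₂})) ?_) ?_
  · have a1 : ∀ᵐ ω ∂P, ∀ e ∈ (S.signals P : Set _), ∀ n, 1 ≤ n → ∀ x : ℝ,
        (∀ Q ∈ S.nullAt e, x ≤ logLik P Q (σ.iso e) n ω) →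
        ENNReal.ofReal (Real.exp x) ≤ σ.LamIso e n ω :=
      (ae_ball_iff (S.signals P).finite_toSet.countable).2 fun e he =>
        σ.ae_le_LamIso hAC hP.1 he
    have a2 : ∀ᵐ ω ∂P, ∀ e ∈ {e ∈ (S.units : Set _) | e ∉ S.signals P}, ∀ n, 1 ≤ n →
        ∀ x : ℝ, (∀ Q ∈ S.altAt e, x ≤ logLik P Q (σ.iso e) n ω) →
        σ.LamIso e n ω ≤ ENNReal.ofReal (Real.exp (-x)) :=
      (ae_ball_iff (S.units.finite_toSet.sep (· ∉ S.signals P)).countable).2 fun e he =>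
        σ.ae_LamIso_le hAC hP he.1 he.2
    filter_upwards [σ.ae_le_LamDet hAC hP.1 he₀, a1, a2] with ω hω hω₁ hω₂ n hn hNn hbad
    have hn0 : (0 : ℝ) < n := by exact_mod_cast hn
    have hNn' : (N : ℝ) ≤ n := by exact_mod_cast hNn
    simp only [Set.mem_union, Set.mem_iUnion, Set.mem_ofPred_eq, not_or, not_exists,
      not_lt] at hbad
    obtain ⟨⟨b0, b1⟩, b2⟩ := hbad
    have c1 : ∀ e ∈ S.signals P, ENNReal.ofReal (Real.exp (n * ρ₁)) ≤ σ.LamIso e n ω :=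
      fun e he => hω₁ e he n hn _ (b1 e he)
    have c2 : ∀ e ∈ S.units, e ∉ S.signals P →
        σ.LamIso e n ω ≤ ENNReal.ofReal (Real.exp (-(n * ρ₂))) :=
      fun e hu he => hω₂ e ⟨hu, he⟩ n hn _ (b2 e ⟨hu, he⟩)
    refine (min_le_right _ _).trans (firstTime_le hn ⟨⟨e₀, hsu he₀, ?_⟩, fun e hu => ?_, ?_⟩)
    · refine le_trans (ofReal_le_exp_of_log_le (hpos e₀ (hsu he₀)).2.2 (hD.trans ?_))
        (hω n hn (n * ρ) b0)
      gcongr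
    · by_cases he : e ∈ S.signals P
      · refine fun hmem => not_le.2 hmem.2 (le_trans (ofReal_le_exp_of_log_le
          (hpos e hu).2.1 ((hB e he).trans ?_)) (c1 e he))
        gcongr
      · refine fun hmem => not_le.2 hmem.1 ((c2 e hu he).trans (ENNReal.ofReal_le_ofReal ?_))
        rw [Real.exp_neg, one_div]
        refine inv_anti₀ (hpos e hu).1 ((Real.log_le_iff_le_exp (hpos e hu).1).1
          ((hA e hu).trans ?_))
        gcongr
    -- The bounds `exp(nρ₁)` and `exp(-nρ₂)` lie on opposite sides of `1`, so the selection is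
    -- exactly the true set of signals, which is in `Ψ` and non-empty.
    · have hD : σ.Diso n ω = S.signals P := by
        ext e
        simp only [Subsystems.Diso, Finset.mem_filter]
        constructor
        · rintro ⟨hu, h1⟩
          by_contra he
          refine not_le.2 h1 ((c2 e hu he).trans ?_)
          rw [ENNReal.ofReal_le_one, Real.exp_le_one_iff]
          nlinarith
        · refine fun he => ⟨hsu he, lt_of_lt_of_le ?_ (c1 e he)⟩
          rw [ENNReal.one_lt_ofReal, Real.one_lt_exp_iff]
          positivity
      rw [hD]
      exact ⟨hP.1.2.2, (S.signals_nonempty hP).ne_empty⟩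
  · gcongr with n
    exact (measure_union_le _ _).trans (add_le_add_left (measure_union_le _ _) _)

end UpperBound

/-! ### Matching the bounds and the asymptotic optimality results. -/

section AsymptoticComparison

lemma tendsto_div_of_bounds {L : ℕ → ℝ} (hL : Tendsto L atTop atTop) {I : ℝ} (hI : 0 < I)
    {x : ℕ → ℝ≥0∞} (hlow : ∀ r, I < r → ∀ᶠ i in atTop, ENNReal.ofReal (L i / r) ≤ x i)
    (hup : ∀ r, 0 < r → r < I → ∀ᶠ i in atTop, x i ≤ ENNReal.ofReal (L i / r)) :
    Tendsto (fun i => x i / (ENNReal.ofReal (L i) / ENNReal.ofReal I)) atTop (𝓝 1) := by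
  have hcont : Tendsto (fun r => ENNReal.ofReal (I / r)) (𝓝 I) (𝓝 1) := by
    have : ContinuousAt (fun r : ℝ => I / r) I := continuousAt_const.div continuousAt_id hI.ne'
    have h := ENNReal.tendsto_ofReal this.tendsto
    rwa [div_self hI.ne', ENNReal.ofReal_one] at h
  have hratio : ∀ r, 0 < r → ∀ i, 0 < L i →
      ENNReal.ofReal (L i / r) / (ENNReal.ofReal (L i) / ENNReal.ofReal I) =
        ENNReal.ofReal (I / r) := by
    intro r hr i hi
    rw [← ENNReal.ofReal_div_of_pos hI, ← ENNReal.ofReal_div_of_pos (div_pos hi hI)]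
    congr 1
    field_simp
  refine tendsto_order.2 ⟨fun a ha => ?_, fun a ha => ?_⟩
  · obtain ⟨r, hr, hIr⟩ := (((hcont.mono_left nhdsWithin_le_nhds).eventually
      (lt_mem_nhds ha)).and (self_mem_nhdsWithin (s := Set.Ioi I))).exists
    have hIr : I < r := hIr
    filter_upwards [hlow r hIr, hL.eventually_gt_atTop 0] with i hi hLi
    refine hr.trans_le ?_
    rw [← hratio r (hI.trans hIr) i hLi]
    gcongr
  · obtain ⟨r, hr, hIr⟩ := (((hcont.mono_left nhdsWithin_le_nhds).eventually
      (gt_mem_nhds ha)).and (Ioo_mem_nhdsLT hI)).exists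
    filter_upwards [hup r hIr.1 hIr.2, hL.eventually_gt_atTop 0] with i hi hLi
    refine lt_of_le_of_lt ?_ hr
    rw [← hratio r hIr.1 i hLi]
    gcongr

/-- Matching asymptotic bounds determine both the optimum and the performance of the test that
attains it. -/
lemma asympEq_of_bounds {L : ℕ → ℝ} (hL : Tendsto L atTop atTop) {I : ℝ} (hI : 0 < I)
    {x o : ℕ → ℝ≥0∞} (hox : ∀ i, o i ≤ x i)
    (hlow : ∀ r, I < r → ∀ᶠ i in atTop, ENNReal.ofReal (L i / r) ≤ o i)
    (hup : ∀ r, 0 < r → r < I → ∀ᶠ i in atTop, x i ≤ ENNReal.ofReal (L i / r)) :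
    AsympEq x (fun i => ENNReal.ofReal (L i) / ENNReal.ofReal I) ∧
      AsympEq (fun i => ENNReal.ofReal (L i) / ENNReal.ofReal I) o := by
  refine ⟨tendsto_div_of_bounds hL hI (fun r hr => (hlow r hr).mono fun i hi =>
    hi.trans (hox i)) hup, ?_⟩
  have h := (tendsto_div_of_bounds hL hI hlow fun r hr hrI => (hup r hr hrI).mono fun i hi =>
    (hox i).trans hi).inv
  rw [inv_one] at h
  -- The second equivalence has the optimum in the denominator; inverting the quotient in `ℝ≥0∞`
  -- requires the rate to be finite and non-zero, which holds once `L i > 0`.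
  refine h.congr' ?_
  filter_upwards [hL.eventually_gt_atTop 0] with i hi
  refine ENNReal.inv_div (Or.inl ?_) (Or.inl ?_)
  · rw [← ENNReal.ofReal_div_of_pos hI]
    exact ENNReal.ofReal_ne_top
  · rw [← ENNReal.ofReal_div_of_pos hI]
    exact (ENNReal.ofReal_pos.2 (div_pos hi hI)).ne'

/-- Take `N = ⌈L / r'⌉`: rounding and the constants cost at most `2 + c`, which the diverging gap
`(1/r - 1/r') L` eventually exceeds. -/
lemma eventually_le_of_le_natCast_add {L : ℕ → ℝ} (hL : Tendsto L atTop atTop)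
    {x : ℕ → ℝ≥0∞} {c : ℝ≥0∞} (hc : c < ∞) {r r' : ℝ} (hr : 0 < r) (hrr' : r < r')
    (h : ∀ᶠ i in atTop, ∀ N : ℕ, L i / r' ≤ N → x i ≤ N + 1 + c) :
    ∀ᶠ i in atTop, x i ≤ ENNReal.ofReal (L i / r) := by
  have hr' := hr.trans hrr'
  have hpos : 0 < r⁻¹ - r'⁻¹ := sub_pos.2 (inv_strictAnti₀ hr hrr')
  filter_upwards [h, hL.eventually_ge_atTop 0,
    (hL.const_mul_atTop hpos).eventually_ge_atTop (2 + c.toReal)] with i hi hLi hbig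
  refine (hi _ (Nat.le_ceil _)).trans ?_
  have h1 : ((⌈L i / r'⌉₊ : ℝ≥0∞)) + 1 + c =
      ENNReal.ofReal (⌈L i / r'⌉₊ + 1 + c.toReal) := by
    rw [ENNReal.ofReal_add (by positivity) ENNReal.toReal_nonneg,
      ENNReal.ofReal_add (by positivity) zero_le_one, ENNReal.ofReal_toReal hc.ne]
    simp
  rw [h1]
  refine ENNReal.ofReal_le_ofReal ?_
  have h2 : (⌈L i / r'⌉₊ : ℝ) < L i / r' + 1 := Nat.ceil_lt_add_one (by positivity)
  have h3 : L i / r - L i / r' = (r⁻¹ - r'⁻¹) * L i := by ring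
  linarith

variable {K : ℕ} {E : Fin K → Type*} [∀ k, MeasurableSpace (E k)] {S : Problem K E}

lemma IsThresholdSeq.eventually_log_le {a : ℕ → ℝ} {th : ℕ → Finset (Fin K) → ℝ}
    (ha : IsLevelSeq a) (h : IsThresholdSeq S a th) {e : Finset (Fin K)} (he : e ∈ S.units)
    {κ : ℝ} (hκ : 1 < κ) : ∀ᶠ i in atTop, Real.log (th i e) ≤ κ * |Real.log (a i)| := by
  filter_upwards [(h e he).2.eventually (gt_mem_nhds hκ),
    ha.tendsto_abs_log.eventually_gt_atTop 0] with i hi hL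
  exact ((div_lt_iff₀ hL).1 hi).le

lemma IsThresholdSeq.eventually_log_le_of_isLittleO {a : ℕ → ℝ} {th : ℕ → Finset (Fin K) → ℝ}
    (ha : IsLevelSeq a) (h : IsThresholdSeq S a th) {L : ℕ → ℝ} (hL : Tendsto L atTop atTop)
    (hLo : (fun i => |Real.log (a i)|) =o[atTop] L) {e : Finset (Fin K)} (he : e ∈ S.units)
    {κ : ℝ} (hκ : 0 < κ) : ∀ᶠ i in atTop, Real.log (th i e) ≤ κ * L i := by
  filter_upwards [h.eventually_log_le ha he one_lt_two, hLo.bound (half_pos hκ),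
    hL.eventually_gt_atTop 0] with i h1 h2 h3
  rw [Real.norm_eq_abs, abs_abs, Real.norm_of_nonneg h3.le] at h2
  linarith

lemma infoFam_le (P : Measure (Obs E)) {𝒬 : Set (Measure (Obs E))} (s : Finset (Fin K))
    {Q : Measure (Obs E)} (hQ : Q ∈ 𝒬) : infoFam P 𝒬 s ≤ ENNReal.ofReal (info P Q s) :=
  iInf₂_le (f := fun Q (_ : Q ∈ 𝒬) => ENNReal.ofReal (info P Q s)) Q hQ

lemma lt_info_of_lt_infoFam {P : Measure (Obs E)} {𝒬 : Set (Measure (Obs E))}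
    {s : Finset (Fin K)} {ρ : ℝ} (h : ENNReal.ofReal ρ < infoFam P 𝒬 s)
    {Q : Measure (Obs E)} (hQ : Q ∈ 𝒬) : ρ < info P Q s :=
  (ENNReal.ofReal_lt_ofReal_iff'.1 (h.trans_le (infoFam_le P s hQ))).1

lemma exists_infoFam_eq (P : Measure (Obs E)) {𝒬 : Set (Measure (Obs E))} (hfin : 𝒬.Finite)
    (hne : 𝒬.Nonempty) (s : Finset (Fin K)) :
    ∃ Q ∈ 𝒬, infoFam P 𝒬 s = ENNReal.ofReal (info P Q s) := by
  obtain ⟨Q, hQ, hmin⟩ := Set.exists_min_image 𝒬 (fun Q => info P Q s) hfin hne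
  exact ⟨Q, hQ, le_antisymm (infoFam_le P s hQ)
    (le_iInf₂ fun Q' hQ' => ENNReal.ofReal_le_ofReal (hmin Q' hQ'))⟩

/-- Turns the familywise rate into the information against one finite family, so that a single least
favourable `Q` yields the lower bound. -/
lemma iInf_min_infoFam (P : Measure (Obs E)) (s : Finset (Fin K)) (I : Finset (Finset (Fin K)))
    (𝒬 : Set (Measure (Obs E))) (ℛ : Finset (Fin K) → Set (Measure (Obs E))) :
    ⨅ e ∈ I, min (infoFam P 𝒬 s) (infoFam P (ℛ e) s) =
      infoFam P (⋃ e ∈ I, 𝒬 ∪ ℛ e) s := by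
  simp only [infoFam, iInf_iUnion, iInf_union]

variable {P : Measure (Obs E)}

lemma Problem.isInfoNumber_info (hInfo : S.HasInfoNumbers) (hP : P ∈ S.distsPsi) {e : Finset (Fin K)}
    (he : e ∈ S.signals P) {s : Finset (Fin K)} (hs : e ⊆ s) {Q : Measure (Obs E)}
    (hQ : Q ∈ S.nullAt e ∪ S.globalNull) : IsInfoNumber P Q s (info P Q s) :=
  isInfoNumber_info_of_exists (hInfo e (S.signals_subset_units P he) P ⟨hP, he⟩ Q hQ s hs).1

/-- No subsystem has more information than the whole system, by `IsInfoNumber.mono`. -/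
lemma Subsystems.iSup_infoFam_det_eq (σ : Subsystems S) (hAC : S.MutuallyAC)
    (hInfo : S.HasInfoNumbers) (hP : P ∈ S.distsPsi)
    (h : ∃ e ∈ S.signals P, σ.det e = Finset.univ) :
    ⨆ e ∈ S.signals P, infoFam P S.globalNull (σ.det e) =
      infoFam P S.globalNull Finset.univ := by
  have := S.dists_prob P hP.1
  refine le_antisymm (iSup₂_le fun e he => iInf₂_mono fun Q hQ => ENNReal.ofReal_le_ofReal ?_) ?_
  · have hu := S.signals_subset_units P he
    have := S.dists_prob Q hQ.1
    exact (S.isInfoNumber_info hInfo hP he (σ.subset_det e hu) (Or.inr hQ)).mono (Finset.subset_univ _)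
      (S.isInfoNumber_info hInfo hP he (Finset.subset_univ _) (Or.inr hQ)) fun n hn =>
      (hAC e hu P (Or.inl ⟨hP, he⟩) Q (Or.inr hQ) _ (Finset.subset_univ _) n hn).1
  · obtain ⟨e, he, hdet⟩ := h
    rw [← hdet]
    exact le_iSup₂ (f := fun e (_ : e ∈ S.signals P) => infoFam P S.globalNull (σ.det e)) e he

lemma Subsystems.exists_infoFam_det_eq (σ : Subsystems S) (hP : P ∈ S.distsPsi \ S.globalNull)
    (h : ⨆ e ∈ S.signals P, infoFam P S.globalNull (σ.det e) =
      infoFam P S.globalNull Finset.univ) :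
    ∃ e ∈ S.signals P, infoFam P S.globalNull (σ.det e) = infoFam P S.globalNull Finset.univ := by
  obtain ⟨e, he, hmax⟩ := (S.signals P).exists_max_image
    (fun e => infoFam P S.globalNull (σ.det e)) (S.signals_nonempty hP)
  exact ⟨e, he, h ▸ le_antisymm
    (le_iSup₂ (f := fun e (_ : e ∈ S.signals P) => infoFam P S.globalNull (σ.det e)) e he)
    (iSup₂_le hmax)⟩

lemma Problem.exists_infoFam_globalNull (hInfo : S.HasInfoNumbers)
    (hP : P ∈ S.distsPsi \ S.globalNull) (hne : S.globalNull.Nonempty) :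
    ∃ Q ∈ S.globalNull, 0 < info P Q Finset.univ ∧
      infoFam P S.globalNull Finset.univ = ENNReal.ofReal (info P Q Finset.univ) := by
  obtain ⟨e, he⟩ := S.signals_nonempty hP
  obtain ⟨Q, hQ, h⟩ := exists_infoFam_eq P S.globalNull_finite hne Finset.univ
  exact ⟨Q, hQ, (S.isInfoNumber_info hInfo hP.1 he (Finset.subset_univ _) (Or.inr hQ)).pos, h⟩

/-- The universal lower bound for tests that control the detection errors. -/
lemma Problem.eventually_le_optTime_of_subset_detClass (hAC : S.MutuallyAC)
    (hInfo : S.HasInfoNumbers) (hP : P ∈ S.distsPsi \ S.globalNull) {α β : ℕ → ℝ}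
    (hα : IsLevelSeq α) (hβ : IsLevelSeq β) {𝒞 : ℕ → Set (Problem.Pair E)}
    (h𝒞 : ∀ i, 𝒞 i ⊆ S.detClass (α i) (β i)) {Q : Measure (Obs E)} (hQ : Q ∈ S.globalNull)
    {r : ℝ} (hr : info P Q Finset.univ < r) :
    ∀ᶠ i in atTop, ENNReal.ofReal (|Real.log (α i)| / r) ≤ optTime P (𝒞 i) := by
  obtain ⟨e, he⟩ := S.signals_nonempty hP
  have := S.dists_prob P hP.1.1
  have := S.dists_prob Q hQ.1
  -- Selecting anything is a false alarm under `Q`; selecting nothing is a missed detection under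
  -- `P`.
  refine eventually_le_optTime (S := S) hα hβ (fun n hn => (hAC e (S.signals_subset_units P he) P
    (Or.inl ⟨hP.1, he⟩) Q (Or.inr hQ) _ (Finset.subset_univ _) n hn).1)
    (S.isInfoNumber_info hInfo hP.1 he (Finset.subset_univ _) (Or.inr hQ)) (fun A => A ≠ ∅)
    (fun i χ hχ => ?_) hr
  obtain ⟨hT, h1, h2⟩ := h𝒞 i hχ
  refine ⟨hT, h1 Q hQ, ?_⟩
  simpa using h2 P hP

/-- Under the global null any selection is a false positive, and under a non-null distribution an
empty selection misses a signal. That `∅ ∈ Ψ` places the global null inside `𝒫_Ψ`, where the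
familywise constraints apply. -/
lemma Problem.fwerClass_subset_detClass (hempty : ∅ ∈ S.Psi) (γ δ : ℝ) :
    S.fwerClass γ δ ⊆ S.detClass γ δ := by
  rintro χ ⟨hT, h⟩
  refine ⟨hT, fun P hP => ?_, fun P hP => ?_⟩
  · have h0 := S.signals_of_mem_globalNull hP
    simpa [h0] using (h P ⟨hP.1, hP.2.1, by rw [h0]; exact hempty⟩).1
  · refine le_trans (measure_mono fun ω hω => ?_) (h P hP.1).2
    refine ⟨hω.1, ?_⟩
    rw [hω.2, Finset.sdiff_empty]
    exact (S.signals_nonempty hP).ne_empty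

/-- The lower bound for tests with familywise error control, against a non-null distribution. -/
lemma Problem.eventually_le_optTime_fwerClass (hAC : S.MutuallyAC)
    (hInfo : S.HasInfoNumbers) (hP : P ∈ S.distsPsi) {γ δ : ℕ → ℝ}
    (hγ : IsLevelSeq γ) (hδ : IsLevelSeq δ) {e : Finset (Fin K)} (he : e ∈ S.signals P)
    {Q : Measure (Obs E)} (hQ : Q ∈ S.nullAt e) {r : ℝ} (hr : info P Q Finset.univ < r) :
    ∀ᶠ i in atTop, ENNReal.ofReal (|Real.log (γ i)| / r) ≤
      optTime P (S.fwerClass (γ i) (δ i)) := by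
  have := S.dists_prob P hP.1
  have := S.dists_prob Q hQ.1.1.1
  -- Selecting `e` is a false positive under `Q`; omitting it is a false negative under `P`.
  refine eventually_le_optTime (S := S) hγ hδ (fun n hn => (hAC e (S.signals_subset_units P he) P
    (Or.inl ⟨hP, he⟩) Q (Or.inl hQ) _ (Finset.subset_univ _) n hn).1)
    (S.isInfoNumber_info hInfo hP he (Finset.subset_univ _) (Or.inl hQ)) (fun A => e ∈ A)
    (fun i χ hχ => ⟨hχ.1, ?_, ?_⟩) hr
  · refine le_trans (measure_mono fun ω hω => ?_) (hχ.2 Q hQ.1.1).1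
    refine ⟨hω.1, ?_⟩
    exact Finset.ne_empty_of_mem (Finset.mem_sdiff.2 ⟨hω.2, hQ.2⟩)
  · refine le_trans (measure_mono fun ω hω => ?_) (hχ.2 P hP).2
    refine ⟨hω.1, ?_⟩
    exact Finset.ne_empty_of_mem (Finset.mem_sdiff.2 ⟨he, hω.2⟩)

lemma optTime_le_expTime {P : Measure (Obs E)} {𝒞 : Set (Problem.Pair E)}
    {χ : Problem.Pair E} (h : χ ∈ 𝒞) : optTime P 𝒞 ≤ expTime P χ.1 :=
  iInf₂_le (f := fun (χ : Problem.Pair E) (_ : χ ∈ 𝒞) => expTime P χ.1) χ h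

/-- Any uniform positive rate suffices against thresholds of smaller logarithmic order; finiteness
of the families provides one. -/
lemma Subsystems.exists_pos_lt_info_iso_of_notMem (σ : Subsystems S) (hInfo : S.HasInfoNumbers)
    (hP : P ∈ S.distsPsi \ S.globalNull) :
    ∃ ρ, 0 < ρ ∧ ∀ e ∈ S.units, e ∉ S.signals P → ∀ Q ∈ S.altAt e, ρ < info P Q (σ.iso e) := by
  obtain ⟨ρ, h0, h⟩ := exists_pos_forall_lt (I := {x : Finset (Fin K) × Measure (Obs E) |
      x.1 ∈ S.units ∧ x.1 ∉ S.signals P ∧ x.2 ∈ S.altAt x.1})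
    ((S.units.finite_toSet.prod S.distsPsi_finite).subset fun x hx => ⟨hx.1, hx.2.2.1⟩)
    (f := fun x => info P x.2 (σ.iso x.1)) fun x hx => (isInfoNumber_info_of_exists
      (hInfo x.1 hx.1 x.2 hx.2.2 P (Or.inl ⟨hP, hx.2.1⟩) _ (σ.subset_iso x.1 hx.1)).2).pos
  exact ⟨ρ, h0, fun e hu he Q hQ => h (e, Q) ⟨hu, he, hQ⟩⟩

lemma Subsystems.exists_pos_lt_info_iso_of_mem (σ : Subsystems S) (hInfo : S.HasInfoNumbers)
    (hP : P ∈ S.distsPsi) :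
    ∃ ρ, 0 < ρ ∧ ∀ e ∈ S.signals P, ∀ Q ∈ S.nullAt e, ρ < info P Q (σ.iso e) := by
  obtain ⟨ρ, h0, h⟩ := exists_pos_forall_lt (I := {x : Finset (Fin K) × Measure (Obs E) |
      x.1 ∈ S.signals P ∧ x.2 ∈ S.nullAt x.1})
    (((S.signals P).finite_toSet.prod S.distsPsi_finite).subset fun x hx => ⟨hx.1, hx.2.1.1⟩)
    (f := fun x => info P x.2 (σ.iso x.1)) fun x hx => (S.isInfoNumber_info hInfo hP hx.1
      (σ.subset_iso x.1 (S.signals_subset_units P hx.1)) (Or.inl hx.2)).pos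
  exact ⟨ρ, h0, fun e he Q hQ => h (e, Q) ⟨he, hQ⟩⟩

/-- Asymptotic optimality of the test for pure detection. -/
theorem Subsystems.asympEq_TstarDet (σ : Subsystems S) (hAC : S.MutuallyAC)
    (hInfo : S.HasInfoNumbers) (hP : P ∈ S.distsPsi \ S.globalNull)
    (hdet : ⨆ e ∈ S.signals P, infoFam P S.globalNull (σ.det e) =
      infoFam P S.globalNull Finset.univ)
    {α β : ℕ → ℝ} {C D : ℕ → Finset (Fin K) → ℝ} {d : ℕ → Obs E → Finset (Finset (Fin K))}
    (hα : IsLevelSeq α) (hβ : IsLevelSeq β) (hD : IsThresholdSeq S α D)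
    (hmem : ∀ i, (σ.TstarDet (C i) (D i), d i) ∈ S.detClass (α i) (β i)) :
    AsympEq (fun i => expTime P (σ.TstarDet (C i) (D i)))
      (fun i => ENNReal.ofReal |Real.log (α i)| / infoFam P S.globalNull Finset.univ) ∧
    AsympEq (fun i => ENNReal.ofReal |Real.log (α i)| / infoFam P S.globalNull Finset.univ)
      (fun i => optTime P (S.detClass (α i) (β i))) := by
  obtain ⟨Q, hQ, hpos, hI⟩ := S.exists_infoFam_globalNull hInfo hP (σ.globalNull_nonempty hP)
  obtain ⟨e, he, hedet⟩ := σ.exists_infoFam_det_eq hP hdet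
  have hu := S.signals_subset_units P he
  rw [hI] at hedet ⊢
  refine asympEq_of_bounds hα.tendsto_abs_log hpos (fun i => optTime_le_expTime (hmem i))
    (fun r hr => S.eventually_le_optTime_of_subset_detClass hAC hInfo hP hα hβ
      (fun _ => subset_rfl) hQ hr) fun r hr0 hrI => ?_
  -- In `r < r' < ρ < 𝓘`, the rate `ρ` is attainable, `ρ / r' > 1` absorbs the error in `log D ∼
  -- |log α|`, and `r < r'` absorbs the additive constant.
  obtain ⟨r', hrr', hr'I⟩ := exists_between hrI
  obtain ⟨ρ, hr'ρ, hρI⟩ := exists_between hr'I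
  have hr' := hr0.trans hrr'
  obtain ⟨c, hc, hbound⟩ := σ.exists_expTime_TstarDet_le hAC hInfo hP.1 he (hr'.trans hr'ρ)
    fun Q' hQ' => lt_info_of_lt_infoFam
      (hedet ▸ (ENNReal.ofReal_lt_ofReal_iff hpos).2 hρI) hQ'
  refine eventually_le_of_le_natCast_add hα.tendsto_abs_log hc hr0 hrr' ?_
  filter_upwards [hD.eventually_log_le hα hu ((one_lt_div hr').2 hr'ρ)] with i hi N hN
  refine hbound _ _ N ((hD e hu).1 i) (hi.trans ?_)
  calc ρ / r' * |Real.log (α i)| = |Real.log (α i)| / r' * ρ := by ring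
    _ ≤ N * ρ := by gcongr; exact (hr'.trans hr'ρ).le

/-- Asymptotic optimality of the test for joint detection and isolation. -/
theorem Subsystems.asympEq_chiStar (σ : Subsystems S) (hAC : S.MutuallyAC)
    (hInfo : S.HasInfoNumbers) (hP : P ∈ S.distsPsi \ S.globalNull)
    (hdet : ⨆ e ∈ S.signals P, infoFam P S.globalNull (σ.det e) =
      infoFam P S.globalNull Finset.univ)
    {α β γ δ : ℕ → ℝ} {A B C D : ℕ → Finset (Fin K) → ℝ}
    (hα : IsLevelSeq α) (hβ : IsLevelSeq β) (hγ : IsLevelSeq γ) (hδ : IsLevelSeq δ)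
    (ho : (fun i => max |Real.log (γ i)| |Real.log (δ i)|) =o[atTop] fun i => |Real.log (α i)|)
    (hA : IsThresholdSeq S δ A) (hB : IsThresholdSeq S γ B) (hD : IsThresholdSeq S α D)
    (hmem : ∀ i, σ.chiStar (A i) (B i) (C i) (D i) ∈ S.jointClass (α i) (β i) (γ i) (δ i)) :
    AsympEq (fun i => expTime P (σ.chiStar (A i) (B i) (C i) (D i)).1)
      (fun i => ENNReal.ofReal |Real.log (α i)| / infoFam P S.globalNull Finset.univ) ∧
    AsympEq (fun i => ENNReal.ofReal |Real.log (α i)| / infoFam P S.globalNull Finset.univ)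
      (fun i => optTime P (S.jointClass (α i) (β i) (γ i) (δ i))) := by
  have hoγ : (fun i => |Real.log (γ i)|) =o[atTop] fun i => |Real.log (α i)| :=
    (Asymptotics.IsBigO.of_norm_le fun i => by simp).trans_isLittleO ho
  have hoδ : (fun i => |Real.log (δ i)|) =o[atTop] fun i => |Real.log (α i)| :=
    (Asymptotics.IsBigO.of_norm_le fun i => by simp).trans_isLittleO ho
  obtain ⟨Q, hQ, hpos, hI⟩ := S.exists_infoFam_globalNull hInfo hP (σ.globalNull_nonempty hP)
  obtain ⟨e, he, hedet⟩ := σ.exists_infoFam_det_eq hP hdet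
  have hsu := S.signals_subset_units P
  have hL := hα.tendsto_abs_log
  rw [hI] at hedet ⊢
  refine asympEq_of_bounds hL hpos (fun i => optTime_le_expTime (hmem i))
    (fun r hr => S.eventually_le_optTime_of_subset_detClass hAC hInfo hP hα hβ
      (fun _ _ h => h.1) hQ hr) fun r hr0 hrI => ?_
  obtain ⟨r', hrr', hr'I⟩ := exists_between hrI
  obtain ⟨ρ, hr'ρ, hρI⟩ := exists_between hr'I
  have hr' := hr0.trans hrr'
  obtain ⟨ρ₁, hρ₁0, hρ₁⟩ := σ.exists_pos_lt_info_iso_of_mem hInfo hP.1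
  obtain ⟨ρ₂, hρ₂0, hρ₂⟩ := σ.exists_pos_lt_info_iso_of_notMem hInfo hP
  obtain ⟨c, hc, hbound⟩ := σ.exists_expTime_Tstar_le hAC hInfo hP he (hr'.trans hr'ρ) hρ₁0 hρ₂0
    (fun Q' hQ' => lt_info_of_lt_infoFam
      (hedet ▸ (ENNReal.ofReal_lt_ofReal_iff hpos).2 hρI) hQ') hρ₁ hρ₂
  refine eventually_le_of_le_natCast_add hL hc hr0 hrr' ?_
  have key : ∀ {x ρ : ℝ} {i N : ℕ}, 0 < ρ → x ≤ ρ / r' * |Real.log (α i)| →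
      |Real.log (α i)| / r' ≤ N → x ≤ N * ρ := fun {x ρ i N} h0 h1 h2 => by
    calc x ≤ |Real.log (α i)| / r' * ρ := h1.trans_eq (by ring)
      _ ≤ N * ρ := by gcongr
  filter_upwards [hD.eventually_log_le hα (hsu he) ((one_lt_div hr').2 hr'ρ),
    (Filter.eventually_all_finset (S.signals P)).2 fun e he =>
      hB.eventually_log_le_of_isLittleO hγ hL hoγ (hsu he) (div_pos hρ₁0 hr'),
    (Filter.eventually_all_finset S.units).2 fun e he =>
      hA.eventually_log_le_of_isLittleO hδ hL hoδ he (div_pos hρ₂0 hr')] with i hi hi₁ hi₂ N hN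
  exact hbound _ _ _ _ N (fun e he => ⟨(hA e he).1 i, (hB e he).1 i, (hD e he).1 i⟩)
    (key (hr'.trans hr'ρ) hi hN) (fun e he => key hρ₁0 (hi₁ e he) hN)
    (fun e he => key hρ₂0 (hi₂ e he) hN)

/-- Asymptotic optimality of the test with familywise error control. -/
theorem Subsystems.asympEq_chiFwer (σ : Subsystems S) (hAC : S.MutuallyAC)
    (hInfo : S.HasInfoNumbers) (hempty : ∅ ∈ S.Psi) (hP : P ∈ S.distsPsi \ S.globalNull)
    (hdet : ⨆ e ∈ S.signals P, infoFam P S.globalNull (σ.det e) =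
      infoFam P S.globalNull Finset.univ)
    (hiso : ⨅ e ∈ S.signals P, infoFam P (S.nullAt e) (σ.iso e) =
      ⨅ e ∈ S.signals P, infoFam P (S.nullAt e) Finset.univ)
    {γ δ : ℕ → ℝ} {A B : ℕ → Finset (Fin K) → ℝ} (hγ : IsLevelSeq γ) (hδ : IsLevelSeq δ)
    (ho : (fun i => |Real.log (δ i)|) =o[atTop] fun i => |Real.log (γ i)|)
    (hA : IsThresholdSeq S δ A) (hB : IsThresholdSeq S γ B)
    (hmem : ∀ i, σ.chiFwer (A i) (B i) ∈ S.fwerClass (γ i) (δ i)) :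
    AsympEq (fun i => expTime P (σ.chiFwer (A i) (B i)).1)
      (fun i => ⨆ e ∈ S.signals P, ENNReal.ofReal |Real.log (γ i)| /
        min (infoFam P S.globalNull Finset.univ) (infoFam P (S.nullAt e) Finset.univ)) ∧
    AsympEq
      (fun i => ⨆ e ∈ S.signals P, ENNReal.ofReal |Real.log (γ i)| /
        min (infoFam P S.globalNull Finset.univ) (infoFam P (S.nullAt e) Finset.univ))
      (fun i => optTime P (S.fwerClass (γ i) (δ i))) := by
  set 𝒬 : Set (Measure (Obs E)) := ⋃ e ∈ S.signals P, S.globalNull ∪ S.nullAt e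
  have hL := hγ.tendsto_abs_log
  have hsu := S.signals_subset_units P
  have hrate : ∀ i, (⨆ e ∈ S.signals P, ENNReal.ofReal |Real.log (γ i)| /
      min (infoFam P S.globalNull Finset.univ) (infoFam P (S.nullAt e) Finset.univ)) =
      ENNReal.ofReal |Real.log (γ i)| / infoFam P 𝒬 Finset.univ := fun i => by
    simp only [← iInf_min_infoFam P Finset.univ (S.signals P) S.globalNull S.nullAt, 𝒬,
      div_eq_mul_inv, ENNReal.inv_iInf, ENNReal.mul_iSup]
  have hfin : 𝒬.Finite := (S.signals P).finite_toSet.biUnion fun e _ =>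
    S.globalNull_finite.union (S.nullAt_finite e)
  obtain ⟨e, he, hedet⟩ := σ.exists_infoFam_det_eq hP hdet
  have hne : 𝒬.Nonempty := by
    obtain ⟨Q, hQ⟩ := σ.globalNull_nonempty hP
    exact ⟨Q, Set.mem_iUnion₂.2 ⟨e, he, Or.inl hQ⟩⟩
  obtain ⟨Q, hQ, hI⟩ := exists_infoFam_eq P hfin hne Finset.univ
  obtain ⟨e', he', hQe'⟩ := Set.mem_iUnion₂.1 hQ
  have hpos : 0 < info P Q Finset.univ :=
    (S.isInfoNumber_info hInfo hP.1 he' (Finset.subset_univ _) hQe'.symm).pos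
  have hI0 : ENNReal.ofReal (info P Q Finset.univ) ≤ infoFam P S.globalNull (σ.det e) := by
    rw [hedet, ← hI]
    exact le_iInf₂ fun Q' hQ' => infoFam_le P _ (Set.mem_iUnion₂.2 ⟨e, he, Or.inl hQ'⟩)
  have hI1 : ∀ e ∈ S.signals P,
      ENNReal.ofReal (info P Q Finset.univ) ≤ infoFam P (S.nullAt e) (σ.iso e) := by
    intro e he
    -- The hypothesis equates only the minima over the signals. This suffices, as each isolation
    -- rate just has to be at least the overall minimum.
    refine le_trans ?_ (iInf₂_le (f := fun e (_ : e ∈ S.signals P) =>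
      infoFam P (S.nullAt e) (σ.iso e)) e he)
    rw [hiso, ← hI]
    exact le_iInf₂ fun e he => le_iInf₂ fun Q' hQ' =>
      infoFam_le P _ (Set.mem_iUnion₂.2 ⟨e, he, Or.inr hQ'⟩)
  simp only [hrate, hI]
  refine asympEq_of_bounds hL hpos (fun i => optTime_le_expTime (hmem i))
    (fun r hr => ?_) fun r hr0 hrI => ?_
  · rcases hQe' with hQ0 | hQ1
    · exact S.eventually_le_optTime_of_subset_detClass hAC hInfo hP hγ hδ
        (fun _ => S.fwerClass_subset_detClass hempty _ _) hQ0 hr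
    · exact S.eventually_le_optTime_fwerClass hAC hInfo hP.1 hγ hδ he' hQ1 hr
  obtain ⟨r', hrr', hr'I⟩ := exists_between hrI
  obtain ⟨ρ, hr'ρ, hρI⟩ := exists_between hr'I
  have hr' := hr0.trans hrr'
  have hρ0 := hr'.trans hr'ρ
  have hρI' := (ENNReal.ofReal_lt_ofReal_iff hpos).2 hρI
  obtain ⟨ρ₂, hρ₂0, hρ₂⟩ := σ.exists_pos_lt_info_iso_of_notMem hInfo hP
  -- Here `D = B`, so detection and the isolation of signals face thresholds of the same order and
  -- share the rate `ρ`; only `A`, governed by `δ`, is negligible.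
  obtain ⟨c, hc, hbound⟩ := σ.exists_expTime_Tstar_le hAC hInfo hP he hρ0 hρ0 hρ₂0
    (fun Q' hQ' => lt_info_of_lt_infoFam (hρI'.trans_le hI0) hQ')
    (fun e he Q' hQ' => lt_info_of_lt_infoFam (hρI'.trans_le (hI1 e he)) hQ') hρ₂
  refine eventually_le_of_le_natCast_add hL hc hr0 hrr' ?_
  have key : ∀ {x ρ : ℝ} {i N : ℕ}, 0 < ρ → x ≤ ρ / r' * |Real.log (γ i)| →
      |Real.log (γ i)| / r' ≤ N → x ≤ N * ρ := fun {x ρ i N} h0 h1 h2 => by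
    calc x ≤ |Real.log (γ i)| / r' * ρ := h1.trans_eq (by ring)
      _ ≤ N * ρ := by gcongr
  filter_upwards [(Filter.eventually_all_finset (S.signals P)).2 fun e he =>
      hB.eventually_log_le hγ (hsu he) ((one_lt_div hr').2 hr'ρ),
    (Filter.eventually_all_finset S.units).2 fun e he =>
      hA.eventually_log_le_of_isLittleO hδ hL ho he (div_pos hρ₂0 hr')] with i hi₁ hi₂ N hN
  exact hbound _ _ _ _ N (fun e he => ⟨(hA e he).1 i, (hB e he).1 i, (hB e he).1 i⟩)
    (key hρ0 (hi₁ e he) hN) (fun e he => key hρ0 (hi₁ e he) hN)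
    (fun e he => key hρ₂0 (hi₂ e he) hN)

end AsymptoticComparison

end SeqDetIso

theorem theoremP0 {K : ℕ} {E : Fin K → Type*} [∀ k, MeasurableSpace (E k)]
    (S : Problem K E) (σ : Subsystems S)
    (hAC : S.MutuallyAC) (hInfo : S.HasInfoNumbers) (hempty : ∅ ∈ S.Psi)
    (P : Measure (Obs E)) (hP : P ∈ S.distsPsi \ S.globalNull) :
    -- the condition on the detection subsystems holds if one of them is the whole system
    ((∃ e ∈ S.signals P, σ.det e = Finset.univ) →
      (⨆ e ∈ S.signals P, infoFam P S.globalNull (σ.det e))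
        = infoFam P S.globalNull Finset.univ) ∧
    ((⨆ e ∈ S.signals P, infoFam P S.globalNull (σ.det e))
        = infoFam P S.globalNull Finset.univ →
      -- pure detection
      (∀ (α β : ℕ → ℝ) (C D : ℕ → Finset (Fin K) → ℝ)
          (d : ℕ → Obs E → Finset (Finset (Fin K))),
        IsLevelSeq α → IsLevelSeq β →
        IsThresholdSeq S β C → IsThresholdSeq S α D →
        (∀ i, σ.IsDstarDet (C i) (D i) (d i)) →
        (∀ i, (σ.TstarDet (C i) (D i), d i) ∈ S.detClass (α i) (β i)) →
        AsympEq
          (fun i => expTime P (σ.TstarDet (C i) (D i)))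
          (fun i => ENNReal.ofReal |Real.log (α i)| / infoFam P S.globalNull Finset.univ) ∧
        AsympEq
          (fun i => ENNReal.ofReal |Real.log (α i)| / infoFam P S.globalNull Finset.univ)
          (fun i => optTime P (S.detClass (α i) (β i)))) ∧
      -- joint detection and isolation
      (∀ (α β γ δ : ℕ → ℝ) (A B C D : ℕ → Finset (Fin K) → ℝ),
        IsLevelSeq α → IsLevelSeq β → IsLevelSeq γ → IsLevelSeq δ →
        (fun i => max |Real.log (γ i)| |Real.log (δ i)|) =o[atTop] (fun i => |Real.log (α i)|) →
        IsThresholdSeq S δ A → IsThresholdSeq S γ B →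
        IsThresholdSeq S β C → IsThresholdSeq S α D →
        (∀ i, σ.chiStar (A i) (B i) (C i) (D i) ∈ S.jointClass (α i) (β i) (γ i) (δ i)) →
        AsympEq
          (fun i => expTime P (σ.chiStar (A i) (B i) (C i) (D i)).1)
          (fun i => ENNReal.ofReal |Real.log (α i)| / infoFam P S.globalNull Finset.univ) ∧
        AsympEq
          (fun i => ENNReal.ofReal |Real.log (α i)| / infoFam P S.globalNull Finset.univ)
          (fun i => optTime P (S.jointClass (α i) (β i) (γ i) (δ i)))) ∧
      -- familywise error control
      ((⨅ e ∈ S.signals P, infoFam P (S.nullAt e) (σ.iso e))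
          = (⨅ e ∈ S.signals P, infoFam P (S.nullAt e) Finset.univ) →
        ∀ (γ δ : ℕ → ℝ) (A B : ℕ → Finset (Fin K) → ℝ),
        IsLevelSeq γ → IsLevelSeq δ →
        (fun i => |Real.log (δ i)|) =o[atTop] (fun i => |Real.log (γ i)|) →
        IsThresholdSeq S δ A → IsThresholdSeq S γ B →
        (∀ i, σ.chiFwer (A i) (B i) ∈ S.fwerClass (γ i) (δ i)) →
        AsympEq
          (fun i => expTime P (σ.chiFwer (A i) (B i)).1)
          (fun i => ⨆ e ∈ S.signals P, ENNReal.ofReal |Real.log (γ i)|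
            / min (infoFam P S.globalNull Finset.univ)
                (infoFam P (S.nullAt e) Finset.univ)) ∧
        AsympEq
          (fun i => ⨆ e ∈ S.signals P, ENNReal.ofReal |Real.log (γ i)|
            / min (infoFam P S.globalNull Finset.univ)
                (infoFam P (S.nullAt e) Finset.univ))
          (fun i => optTime P (S.fwerClass (γ i) (δ i))))) := by
  refine ⟨σ.iSup_infoFam_det_eq hAC hInfo hP.1, fun hdet => ⟨?_, ?_, ?_⟩⟩
  · intro α β C D d hα hβ _ hD _ hmem
    exact σ.asympEq_TstarDet hAC hInfo hP hdet hα hβ hD hmem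
  · intro α β γ δ A B C D hα hβ hγ hδ ho hA hB _ hD hmem
    exact σ.asympEq_chiStar hAC hInfo hP hdet hα hβ hγ hδ ho hA hB hD hmem
  · intro hiso γ δ A B hγ hδ ho hA hB hmem
    exact σ.asympEq_chiFwer hAC hInfo hempty hP hdet hiso hγ hδ ho hA hB hmem
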